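/- A binary word is a finite sequence of letters in $\{0,1\}$. An occurrence of a binary word $p=p_1\cdots p_l$ in a binary word $w=w_1\cdots w_n$ is a choice of indices $1\le i_1<\cdots<i_l\le n$ with $w_{i_1}\cdots w_{i_l}=p$; let $c_p(w)$ be the number of occurrences. For $n,k\ge 0$ let $B_{n,p}(k)$ be the number of binary words $w$ of length $n$ with $c_p(w)=k$, and let $M_{n,p}$ be the maximum of $c_p(w)$ over all binary words $w$ of length $n$. A run of a word is a maximal non-empty block of consecutive equal letters, its size is its number of letters, and a word is alternating if all its runs have size $1$. The word $p$ has an internal zero at $n$ if there are $0\le k_1<k_2<k_3$ with $B_{n,p}(k_1)\ne 0$, $B_{n,p}(k_2)=0$ and $B_{n,p}(k_3)\neq 0$. **Theorem.** Let $p$ be a binary word of length $l$ with at most $3$ runs. (1) If $p$ is alternating, then $p$ does not have an internal zero at any $n\ge 7$. (2) If $p$ is not alternating, then $p$ has an internal zero at every $n\ge l+3$; in fact, $B_{n,p}(M_{n,p}-1)=0$ for every $n\ge l+3$. -/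

import Mathlib

/-- A binary word is a finite sequence of letters in `{0, 1}`; `false` is `0`, `true` is `1`. -/
abbrev BinaryWord : Type := List Bool

namespace BinaryWord

/-- The occurrences of `p = p_1 ⋯ p_l` in `w = w_1 ⋯ w_n`: the strictly increasing choices of
indices `i_1 < ⋯ < i_l` such that `w_{i_1} ⋯ w_{i_l} = p`. -/
def occurrences (p w : BinaryWord) : Set (Fin p.length → Fin w.length) :=
  {i | StrictMono i ∧ ∀ j, w.get (i j) = p.get j}

/-- `c_p(w)`, the number of occurrences of `p` in `w`. -/
noncomputable def numOcc (p w : BinaryWord) : ℕ := (occurrences p w).ncard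

/-- `B_{n,p}(k)`, the number of binary words of length `n` with exactly `k` occurrences of `p`. -/
noncomputable def countWords (n : ℕ) (p : BinaryWord) (k : ℕ) : ℕ :=
  {w : BinaryWord | w.length = n ∧ numOcc p w = k}.ncard

/-- `M_{n,p}`, the maximum number of occurrences of `p` in a binary word of length `n`. -/
noncomputable def maxOcc (n : ℕ) (p : BinaryWord) : ℕ :=
  sSup {k | ∃ w : BinaryWord, w.length = n ∧ numOcc p w = k}

/-- `M_{n,p}` is really a maximum. -/
theorem isGreatest_maxOcc (n : ℕ) (p : BinaryWord) :
    IsGreatest {k | ∃ w : BinaryWord, w.length = n ∧ numOcc p w = k} (maxOcc n p) := by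
  have hfin : {k | ∃ w : BinaryWord, w.length = n ∧ numOcc p w = k}.Finite :=
    (List.finite_length_eq Bool n).image (numOcc p)
  have hne : {k | ∃ w : BinaryWord, w.length = n ∧ numOcc p w = k}.Nonempty :=
    ⟨_, List.replicate n true, List.length_replicate, rfl⟩
  exact ⟨Nat.sSup_mem hne hfin.bddAbove, fun _ hk => le_csSup hfin.bddAbove hk⟩

/-- The block `w_{i+1} w_{i+2} ⋯ w_{i+k}` (letters numbered from `1`; in the code, `w[a]?` is the
letter numbered `a + 1`) is a run of `w`: it is a non-empty block of consecutive equal letters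
that cannot be extended on either side. -/
def IsRun (w : BinaryWord) (i k : ℕ) : Prop :=
  0 < k ∧ i + k ≤ w.length ∧
    (∀ a b, i ≤ a → a < i + k → i ≤ b → b < i + k → w[a]? = w[b]?) ∧
    (i = 0 ∨ w[i - 1]? ≠ w[i]?) ∧
    (i + k = w.length ∨ w[i + k]? ≠ w[i + k - 1]?)

/-- The number of runs of a binary word. -/
noncomputable def numRuns (w : BinaryWord) : ℕ := {x : ℕ × ℕ | IsRun w x.1 x.2}.ncard

/-- The set of runs is finite, so that `numRuns` is really its number of elements. -/
theorem finite_runs (w : BinaryWord) : {x : ℕ × ℕ | IsRun w x.1 x.2}.Finite := by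
  refine ((Set.finite_Iic w.length).prod (Set.finite_Iic w.length)).subset ?_
  rintro ⟨i, k⟩ ⟨_, h, _⟩
  simp only [Set.mem_prod, Set.mem_Iic]
  simp only at h
  omega

/-- A binary word is alternating if all its runs are of size `1`. -/
def IsAlternating (w : BinaryWord) : Prop := ∀ i k, IsRun w i k → k = 1

/-- The sequence `a` has an internal zero. -/
def HasInternalZero (a : ℕ → ℕ) : Prop :=
  ∃ k₁ k₂ k₃, k₁ < k₂ ∧ k₂ < k₃ ∧ a k₁ ≠ 0 ∧ a k₂ = 0 ∧ a k₃ ≠ 0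

end BinaryWord

/-!
Write `p = s ^ a t ^ b s ^ c`, where `s` and `t` are the two letters. The occurrences of `p` in `w`
are sorted by the set `S` of positions of the middle block `t ^ b` (`numOcc_three_blocks`): there
are `C(L, a) C(R, c)` of them, where `L` and `R` count the letters `s` to the left and to the right
of `S`.

**Words that are not alternating.** The values on words `s ^ i t ^ m s ^ j` are
`C(i, a) C(m, b) C(j, c)`, and `M` is one of them. None of them is `M - 1`
(`three_choose_add_one_ne`): since binomial coefficients are log-concave, a triple that is not
maximal is improved by moving one unit from one entry to another
(`prod_choose_le_of_forall_exchange_le`). From the value `M - 1` this leads to `M`, and the factor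
left unchanged divides both, so it is `1`; the other two factors are then excluded by a direct
computation (`choose_mul_choose_succ_ne_add_one`).
For an arbitrary word `w` with `z` letters `s` and `m` letters `t`, each of the `C(m, b)` sets `S`
contributes at most the maximum `g` of `C(x, a) C(z - x, c)`, and `C(m, b) g` is the value on a word
`s ^ i t ^ m s ^ j`. So if `w` has the value `M - 1`, then `C(m, b) g = M` and exactly one `S`
contributes less than `g`, namely `g - 1`. But every `S` that is interrupted by a letter `s`
contributes less than `g` (`blockWeight_lt`). If `b ≥ 2` and `m > b`, then two letters `t`
separated by a letter `s` lie in at least two such `S`; and if no two letters `t` are separated,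
then all `S` contribute the same. The remaining cases `b = 1` and `m = b` come down to two factors
and to a small value of `M`. Words with two runs are treated in the same way, and words with one run
directly.

**Alternating words.** The words `s` and `s t` are easy: replacing a factor `s t` of `w` by `t s`
removes exactly one occurrence of `s t`. For `s t s`, a letter `t` of `w` with `x` of the `z`
letters `s` to its left contributes `x (z - x)`, and the maximum is `m q ^ 2` for some
`2 q + m = n`. With `z = 2 q`, a letter `t` with `q - d` letters `s` on its left contributes
`q ^ 2 - d ^ 2`; if `m ≥ 4`, four of them are free to use different `d`, so by Lagrange's
four-square theorem every number from `(m - 1) q ^ 2` to `m q ^ 2` is a value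
(`exists_numOcc_triple_eq_of_four_le`); smaller numbers are values already for words of length
`n - 1`. Only `n = 7, 8, 9, 11` need explicit words.
-/

namespace BinaryWord

/-! ### Counting occurrences letter by letter -/

theorem numOcc_nil_left (w : BinaryWord) : numOcc [] w = 1 := by
  have h : occurrences [] w = {fun j => absurd j.2 (Nat.not_lt_zero _)} := by
    ext i
    simp only [Set.mem_singleton_iff]
    refine ⟨fun _ => funext fun j => absurd j.2 (Nat.not_lt_zero _), fun _ => ?_⟩
    exact ⟨fun j => absurd j.2 (Nat.not_lt_zero _), fun j => absurd j.2 (Nat.not_lt_zero _)⟩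
  rw [numOcc, h, Set.ncard_singleton]

theorem numOcc_cons_nil (a : Bool) (p : BinaryWord) : numOcc (a :: p) [] = 0 := by
  have h : occurrences (a :: p) [] = ∅ := by
    ext i
    exact absurd (i ⟨0, Nat.succ_pos _⟩).2 (Nat.not_lt_zero _)
  rw [numOcc, h, Set.ncard_empty]

/-- An occurrence of `a :: p` in `b :: w` either avoids the first letter `b`, or uses it for `a`. -/
theorem numOcc_cons_cons (a b : Bool) (p w : BinaryWord) :
    numOcc (a :: p) (b :: w) = numOcc (a :: p) w + if a = b then numOcc p w else 0 := by
  let f : (Fin (p.length + 1) → Fin w.length) → (Fin (p.length + 1) → Fin (w.length + 1)) :=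
    fun i j => (i j).succ
  let g : (Fin p.length → Fin w.length) → (Fin (p.length + 1) → Fin (w.length + 1)) :=
    fun i => Fin.cons 0 fun j => (i j).succ
  have hf : Function.Injective f := fun i i' h =>
    funext fun j => Fin.succ_injective _ (congrFun h j)
  have hg : Function.Injective g := fun i i' h =>
    funext fun j => Fin.succ_injective _ (by simpa [g] using congrFun h j.succ)
  have hget : ∀ (x : Fin (w.length + 1)) (hx : x ≠ 0), (b :: w).get x = w.get (x.pred hx) :=
    fun x => Fin.cases (fun hx => absurd rfl hx) (fun x _ => rfl) x
  have hset : occurrences (a :: p) (b :: w) =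
      f '' occurrences (a :: p) w ∪ if a = b then g '' occurrences p w else ∅ := by
    ext i
    change (Fin (p.length + 1) → Fin (w.length + 1)) at i
    constructor
    · rintro ⟨hi, hl⟩
      change ∀ j : Fin (p.length + 1), (b :: w).get (i j) = (a :: p).get j at hl
      by_cases h0 : i 0 = 0
      · have hab : a = b := by simpa [h0] using (hl 0).symm
        have hne : ∀ j : Fin p.length, i j.succ ≠ 0 := fun j hj => by
          have := hi (Fin.succ_pos j)
          rw [hj] at this
          exact absurd this (Fin.not_lt_zero _)
        refine Or.inr ?_
        rw [if_pos hab]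
        refine ⟨fun j => (i j.succ).pred (hne j), ⟨?_, ?_⟩, ?_⟩
        · intro j j' hj
          exact Fin.pred_lt_pred_iff.2 (hi (Fin.succ_lt_succ_iff.2 hj))
        · intro j
          rw [← hget _ (hne j)]
          exact hl j.succ
        · funext j
          refine Fin.cases ?_ (fun j => ?_) j
          · simp [g, h0]
          · simp [g]
      · have hne : ∀ j, i j ≠ 0 := fun j hj => by
          have := hi.monotone (Fin.zero_le j)
          change i 0 ≤ i j at this
          rw [hj] at this
          exact h0 (Fin.le_zero_iff.1 this)
        refine Or.inl ⟨fun j => (i j).pred (hne j), ⟨?_, ?_⟩, ?_⟩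
        · intro j j' hj
          exact Fin.pred_lt_pred_iff.2 (hi hj)
        · intro j
          rw [← hget _ (hne j)]
          exact hl j
        · funext j
          simp [f]
    · rintro (⟨i', ⟨hi, hl⟩, rfl⟩ | h)
      · exact ⟨fun j j' hj => Fin.succ_lt_succ_iff.2 (hi hj), fun j => hl j⟩
      · split_ifs at h with hab
        · obtain ⟨i', ⟨hi, hl⟩, rfl⟩ := h
          refine ⟨?_, ?_⟩
          · change StrictMono (g i')
            intro j j'
            refine Fin.cases ?_ (fun j => ?_) j <;> refine Fin.cases ?_ (fun j' => ?_) j'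
            · simp
            · intro _
              simp [g]
            · intro h
              exact absurd h (Fin.not_lt_zero _)
            · intro h
              simpa [g] using hi (Fin.succ_lt_succ_iff.1 h)
          · change ∀ j : Fin (p.length + 1), (b :: w).get (g i' j) = (a :: p).get j
            intro j
            refine Fin.cases ?_ (fun j => ?_) j
            · simp [g, hab]
            · simpa [g] using hl j
        · exact absurd h (Set.notMem_empty _)
  have hdisj : Disjoint (f '' occurrences (a :: p) w)
      (if a = b then g '' occurrences p w else ∅) := by
    rw [Set.disjoint_left]
    rintro _ ⟨i, _, rfl⟩ h
    split_ifs at h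
    · obtain ⟨i', _, h⟩ := h
      have := congrFun h 0
      simp only [f, g, Fin.cons_zero] at this
      exact Fin.succ_ne_zero _ this.symm
    · exact h
  rw [numOcc, hset, Set.ncard_union_eq hdisj (Set.toFinite _) (Set.toFinite _),
    Set.ncard_image_of_injective _ hf]
  split_ifs
  · rw [Set.ncard_image_of_injective _ hg]
    rfl
  · rw [Set.ncard_empty]
    rfl

theorem numOcc_replicate (s : Bool) (k : ℕ) (w : BinaryWord) :
    numOcc (List.replicate k s) w = (w.count s).choose k := by
  induction w generalizing k with
  | nil => cases k <;> simp [numOcc_nil_left, numOcc_cons_nil, List.replicate_succ]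
  | cons b w ih =>
    cases k with
    | zero => simp [numOcc_nil_left]
    | succ k =>
      rw [List.replicate_succ, numOcc_cons_cons, ← List.replicate_succ, ih, ih, List.count_cons]
      by_cases h : s = b
      · subst h
        simp [Nat.choose_succ_succ, add_comm]
      · simp [h, Ne.symm h]

theorem count_add_count_not (s : Bool) (w : BinaryWord) :
    w.count s + w.count (!s) = w.length := List.count_add_count_not w s

/-! ### Words with at most three runs -/

theorem getElem?_replicate_append_of_lt (s : Bool) (k : ℕ) (q : BinaryWord) {a : ℕ} (h : a < k) :
    (List.replicate k s ++ q)[a]? = some s := by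
  rw [List.getElem?_append_left (by simpa using h)]
  simp [h]

theorem getElem?_replicate_append_add (s : Bool) (k : ℕ) (q : BinaryWord) (a : ℕ) :
    (List.replicate k s ++ q)[k + a]? = q[a]? := by
  rw [List.getElem?_append_right (by simp)]
  simp

theorem isRun_replicate_append {s : Bool} {k : ℕ} {q : BinaryWord} (hk : 0 < k)
    (hq : q.head? ≠ some s) : IsRun (List.replicate k s ++ q) 0 k := by
  refine ⟨hk, by simp, fun a b _ ha _ hb => ?_, Or.inl rfl, ?_⟩
  · rw [getElem?_replicate_append_of_lt _ _ _ (by omega),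
      getElem?_replicate_append_of_lt _ _ _ (by omega)]
  · right
    rw [zero_add, getElem?_replicate_append_of_lt (a := k - 1) _ _ _ (by omega)]
    have := getElem?_replicate_append_add s k q 0
    rw [add_zero] at this
    rwa [this, ← List.head?_eq_getElem?]

theorem IsRun.replicate_append {s : Bool} {k : ℕ} {q : BinaryWord} (hk : 0 < k)
    (hq : q.head? ≠ some s) {i j : ℕ} (h : IsRun q i j) :
    IsRun (List.replicate k s ++ q) (k + i) j := by
  obtain ⟨hj, hle, heq, hl, hr⟩ := h
  refine ⟨hj, by simp; omega, fun a b ha ha' hb hb' => ?_, Or.inr ?_, ?_⟩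
  · obtain ⟨a, rfl⟩ := Nat.exists_eq_add_of_le (show k ≤ a by omega)
    obtain ⟨b, rfl⟩ := Nat.exists_eq_add_of_le (show k ≤ b by omega)
    rw [getElem?_replicate_append_add, getElem?_replicate_append_add]
    exact heq a b (by omega) (by omega) (by omega) (by omega)
  · rw [getElem?_replicate_append_add]
    rcases Nat.eq_zero_or_pos i with rfl | hi
    · rw [getElem?_replicate_append_of_lt _ _ _ (by omega), ← List.head?_eq_getElem?]
      exact hq.symm
    · rw [show k + i - 1 = k + (i - 1) by omega, getElem?_replicate_append_add]
      exact hl.resolve_left (by omega)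
  · rcases hr with hr | hr
    · left
      simp
      omega
    · right
      rw [show k + i + j - 1 = k + (i + j - 1) by omega, add_assoc, getElem?_replicate_append_add,
        getElem?_replicate_append_add]
      exact hr

theorem numRuns_lt_replicate_append {s : Bool} {k : ℕ} {q : BinaryWord} (hk : 0 < k)
    (hq : q.head? ≠ some s) : numRuns q < numRuns (List.replicate k s ++ q) := by
  let f : ℕ × ℕ → ℕ × ℕ := fun x => (k + x.1, x.2)
  have hf : Function.Injective f := fun x y h => by
    simp only [f, Prod.mk.injEq, add_right_inj] at h
    exact Prod.ext h.1 h.2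
  have hnot : ((0, k) : ℕ × ℕ) ∉ f '' {x : ℕ × ℕ | IsRun q x.1 x.2} := by
    rintro ⟨x, _, hx⟩
    simp only [f, Prod.mk.injEq] at hx
    omega
  have hsub : insert (0, k) (f '' {x : ℕ × ℕ | IsRun q x.1 x.2}) ⊆
      {x : ℕ × ℕ | IsRun (List.replicate k s ++ q) x.1 x.2} := by
    rintro _ (rfl | ⟨x, hx, rfl⟩)
    · exact isRun_replicate_append hk hq
    · exact IsRun.replicate_append hk hq hx
  have := Set.ncard_le_ncard hsub (finite_runs _)
  rw [Set.ncard_insert_of_notMem hnot ((finite_runs q).image f),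
    Set.ncard_image_of_injective _ hf] at this
  exact this

/-- Splitting off the first run of a non-empty word. -/
theorem exists_eq_replicate_append (s : Bool) (p : BinaryWord) :
    ∃ k q, (s :: p) = List.replicate k s ++ q ∧ 0 < k ∧ q.head? ≠ some s := by
  induction p with
  | nil => exact ⟨1, [], by simp, by simp, by simp⟩
  | cons b p ih =>
    by_cases h : b = s
    · subst h
      obtain ⟨k, q, h, _, hq⟩ := ih
      exact ⟨k + 1, q, by rw [h, List.replicate_succ, List.cons_append], by simp, hq⟩
    · exact ⟨1, b :: p, by simp, by simp, by simpa using h⟩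

/-- Words with at most three runs. -/
theorem eq_of_numRuns_le_three {p : BinaryWord} (hp : numRuns p ≤ 3) :
    p = [] ∨ (∃ s a, 0 < a ∧ p = List.replicate a s) ∨
    (∃ s a b, 0 < a ∧ 0 < b ∧ p = List.replicate a s ++ List.replicate b (!s)) ∨
    (∃ s a b c, 0 < a ∧ 0 < b ∧ 0 < c ∧
      p = List.replicate a s ++ (List.replicate b (!s) ++ List.replicate c s)) := by
  have key : ∀ (s : Bool) (q : BinaryWord), q ≠ [] → q.head? ≠ some s →
      ∃ k q', q = List.replicate k (!s) ++ q' ∧ 0 < k ∧ q'.head? ≠ some (!s) := by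
    intro s q hq h
    cases q with
    | nil => exact absurd rfl hq
    | cons b q =>
      have : b = !s := by
        cases b <;> cases s <;> simp_all
      subst this
      exact exists_eq_replicate_append _ _
  cases p with
  | nil => exact Or.inl rfl
  | cons s p =>
    obtain ⟨a, q, h, ha, hq⟩ := exists_eq_replicate_append s p
    rw [h] at hp ⊢
    have h1 := numRuns_lt_replicate_append ha hq
    by_cases hq0 : q = []
    · exact Or.inr (Or.inl ⟨s, a, ha, by simp [hq0]⟩)
    obtain ⟨b, q, rfl, hb, hq'⟩ := key s q hq0 hq
    have h2 := numRuns_lt_replicate_append hb hq'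
    by_cases hq0 : q = []
    · exact Or.inr (Or.inr (Or.inl ⟨s, a, b, ha, hb, by simp [hq0]⟩))
    obtain ⟨c, q, rfl, hc, hq''⟩ := key (!s) q hq0 hq'
    simp only [Bool.not_not] at hp hq'' h2 h1 ⊢
    have h3 := numRuns_lt_replicate_append hc hq''
    by_cases hq0 : q = []
    · exact Or.inr (Or.inr (Or.inr ⟨s, a, b, c, ha, hb, hc, by simp [hq0]⟩))
    obtain ⟨d, q, rfl, hd, hq'''⟩ := key s q hq0 hq''
    have h4 := numRuns_lt_replicate_append hd hq'''
    omega

theorem IsAlternating.of_replicate_append {s : Bool} {k : ℕ} {q : BinaryWord} (hk : 0 < k)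
    (hq : q.head? ≠ some s) (h : IsAlternating (List.replicate k s ++ q)) :
    k = 1 ∧ IsAlternating q :=
  ⟨h 0 k (isRun_replicate_append hk hq), fun _ _ hr => h _ _ (hr.replicate_append hk hq)⟩

theorem isAlternating_of_getElem?_ne {p : BinaryWord}
    (h : ∀ i, i + 1 < p.length → p[i]? ≠ p[i + 1]?) : IsAlternating p := by
  rintro i k ⟨hk, hle, heq, -, -⟩
  by_contra hne
  exact h i (by omega) (heq i (i + 1) le_rfl (by omega) (by omega) (by omega))

theorem isAlternating_one (s : Bool) : IsAlternating [s] :=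
  isAlternating_of_getElem?_ne fun i hi => by simp at hi

theorem isAlternating_two (s : Bool) : IsAlternating [s, !s] :=
  isAlternating_of_getElem?_ne fun i hi => by
    obtain rfl : i = 0 := by
      simp only [List.length_cons, List.length_nil] at hi
      omega
    simp

theorem isAlternating_three (s : Bool) : IsAlternating [s, !s, s] :=
  isAlternating_of_getElem?_ne fun i hi => by
    have : i < 2 := by
      simp only [List.length_cons, List.length_nil] at hi
      omega
    interval_cases i <;> simp

theorem head?_replicate_append_ne {k : ℕ} (hk : 0 < k) (s : Bool) (q : BinaryWord) :
    (List.replicate k (!s) ++ q).head? ≠ some s := by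
  cases k with
  | zero => exact absurd hk (lt_irrefl 0)
  | succ k => simp [List.replicate_succ]

/-! ### Occurrences sorted by their middle block -/

/-- The positions of the letter `s` in a word, where positions are numbered `0, 1, …` starting
from the *last* letter: prepending a letter then leaves the existing positions unchanged. -/
def positions (s : Bool) : BinaryWord → Finset ℕ
  | [] => ∅
  | b :: w => if b = s then insert w.length (positions s w) else positions s w

theorem lt_length_of_mem_positions {s : Bool} {w : BinaryWord} {k : ℕ}
    (h : k ∈ positions s w) : k < w.length := by
  induction w with
  | nil => simp [positions] at h
  | cons b w ih =>
    rw [positions] at h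
    split_ifs at h
    · rcases Finset.mem_insert.1 h with rfl | h
      · simp
      · exact (ih h).trans (by simp)
    · exact (ih h).trans (by simp)

theorem length_notMem_positions (s : Bool) (w : BinaryWord) : w.length ∉ positions s w :=
  fun h => lt_irrefl _ (lt_length_of_mem_positions h)

theorem positions_cons_self (s : Bool) (w : BinaryWord) :
    positions s (s :: w) = insert w.length (positions s w) := by simp [positions]

theorem positions_not_cons (s : Bool) (w : BinaryWord) :
    positions (!s) (s :: w) = positions (!s) w := by simp [positions]

theorem positions_cons_not (s : Bool) (w : BinaryWord) :
    positions s ((!s) :: w) = positions s w := by simp [positions]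

theorem card_positions (s : Bool) (w : BinaryWord) : (positions s w).card = w.count s := by
  induction w with
  | nil => simp [positions]
  | cons b w ih =>
    rw [positions, List.count_cons]
    by_cases h : b = s
    · simp [h, Finset.card_insert_of_notMem (length_notMem_positions s w), ih]
    · simp [h, ih]

/-- The number of letters `s` of `w` to the right of all positions in `S`. -/
def rightCount (s : Bool) (w : BinaryWord) (S : Finset ℕ) : ℕ :=
  ((positions s w).filter fun k => ∀ i ∈ S, k < i).card

/-- The number of letters `s` of `w` to the left of all positions in `S`. -/
def leftCount (s : Bool) (w : BinaryWord) (S : Finset ℕ) : ℕ :=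
  ((positions s w).filter fun k => ∀ i ∈ S, i < k).card

theorem rightCount_empty (s : Bool) (w : BinaryWord) : rightCount s w ∅ = w.count s := by
  simp [rightCount, card_positions]

theorem rightCount_cons_not (s : Bool) (w : BinaryWord) (S : Finset ℕ) :
    rightCount s ((!s) :: w) S = rightCount s w S := by
  rw [rightCount, rightCount, positions_cons_not]

theorem leftCount_cons_not (s : Bool) (w : BinaryWord) (S : Finset ℕ) :
    leftCount s ((!s) :: w) S = leftCount s w S := by
  rw [leftCount, leftCount, positions_cons_not]

theorem rightCount_insert_length (s : Bool) (w : BinaryWord) (S : Finset ℕ) :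
    rightCount s w (insert w.length S) = rightCount s w S := by
  unfold rightCount
  congr 1
  refine Finset.filter_congr fun k hk => ?_
  simp [lt_length_of_mem_positions hk]

theorem leftCount_insert_length (s : Bool) (w : BinaryWord) (S : Finset ℕ) :
    leftCount s w (insert w.length S) = 0 := by
  unfold leftCount
  rw [Finset.card_eq_zero, Finset.filter_eq_empty_iff]
  intro k hk h
  exact absurd (h _ (Finset.mem_insert_self _ _)) (lt_length_of_mem_positions hk).not_gt

theorem rightCount_cons_self {s : Bool} {w : BinaryWord} {S : Finset ℕ} (hne : S.Nonempty)
    (hS : S ⊆ positions (!s) w) : rightCount s (s :: w) S = rightCount s w S := by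
  unfold rightCount
  rw [positions_cons_self, Finset.filter_insert, if_neg]
  intro h
  obtain ⟨i, hi⟩ := hne
  exact absurd (h i hi) (lt_length_of_mem_positions (hS hi)).not_gt

theorem leftCount_cons_self {s : Bool} {w : BinaryWord} {S : Finset ℕ}
    (hS : S ⊆ positions (!s) w) : leftCount s (s :: w) S = leftCount s w S + 1 := by
  unfold leftCount
  rw [positions_cons_self, Finset.filter_insert, if_pos, Finset.card_insert_of_notMem]
  · intro h
    exact length_notMem_positions s w (Finset.mem_filter.1 h).1
  · exact fun i hi => lt_length_of_mem_positions (hS hi)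

theorem sum_powersetCard_insert {ι : Type*} [DecidableEq ι] {x : ι} {I : Finset ι} (h : x ∉ I)
    (b : ℕ) (f : Finset ι → ℕ) :
    ∑ S ∈ (insert x I).powersetCard (b + 1), f S =
      ∑ S ∈ I.powersetCard (b + 1), f S + ∑ S ∈ I.powersetCard b, f (insert x S) := by
  rw [Finset.powersetCard_succ_insert h, Finset.sum_union, Finset.sum_image]
  · intro S hS S' hS' hSS
    have h1 : x ∉ S := fun hx => h ((Finset.mem_powersetCard.1 hS).1 hx)
    have h2 : x ∉ S' := fun hx => h ((Finset.mem_powersetCard.1 hS').1 hx)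
    rw [← Finset.erase_insert h1, hSS, Finset.erase_insert h2]
  · rw [Finset.disjoint_left]
    intro S hS hS'
    obtain ⟨T, _, rfl⟩ := Finset.mem_image.1 hS'
    exact h ((Finset.mem_powersetCard.1 hS).1 (Finset.mem_insert_self _ _))

theorem numOcc_replicate_append_replicate (s : Bool) (b c : ℕ) (w : BinaryWord) :
    numOcc (List.replicate b (!s) ++ List.replicate c s) w =
      ∑ S ∈ (positions (!s) w).powersetCard b, (rightCount s w S).choose c := by
  induction w generalizing b with
  | nil =>
    cases b with
    | zero => simp [numOcc_replicate, rightCount_empty]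
    | succ b =>
      rw [positions, Finset.powersetCard_eq_empty.2 (by simp)]
      simp [numOcc_cons_nil, List.replicate_succ]
  | cons d w ih =>
    cases b with
    | zero => simp [numOcc_replicate, rightCount_empty]
    | succ b =>
      rw [List.replicate_succ, List.cons_append, numOcc_cons_cons, ← List.cons_append,
        ← List.replicate_succ, ih, ih]
      by_cases hd : d = s
      · subst hd
        rw [if_neg (by simp), add_zero, positions_not_cons]
        refine Finset.sum_congr rfl fun S hS => ?_
        obtain ⟨hS, hc⟩ := Finset.mem_powersetCard.1 hS
        rw [rightCount_cons_self (Finset.card_pos.1 (by omega)) hS]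
      · obtain rfl : d = !s := by cases d <;> cases s <;> simp_all
        rw [if_pos rfl, positions_cons_self, sum_powersetCard_insert (length_notMem_positions _ _)]
        simp only [rightCount_cons_not, rightCount_insert_length]

/-- The number of occurrences of `s ^ a t ^ b s ^ c` (where `t` is the other letter), sorted by
the positions of the block `t ^ b`. -/
theorem numOcc_three_blocks (s : Bool) (a : ℕ) {b : ℕ} (hb : 0 < b) (c : ℕ) (w : BinaryWord) :
    numOcc (List.replicate a s ++ (List.replicate b (!s) ++ List.replicate c s)) w =
      ∑ S ∈ (positions (!s) w).powersetCard b,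
        (leftCount s w S).choose a * (rightCount s w S).choose c := by
  induction w generalizing a with
  | nil =>
    cases a with
    | zero => simp [numOcc_replicate_append_replicate]
    | succ a => simp [numOcc_cons_nil, List.replicate_succ, positions, leftCount]
  | cons d w ih =>
    cases a with
    | zero => simp [numOcc_replicate_append_replicate]
    | succ a =>
      rw [List.replicate_succ, List.cons_append, numOcc_cons_cons, ← List.cons_append,
        ← List.replicate_succ, ih, ih]
      by_cases hd : d = s
      · subst hd
        rw [if_pos rfl, positions_not_cons, ← Finset.sum_add_distrib]
        refine Finset.sum_congr rfl fun S hS => ?_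
        obtain ⟨hS, hc⟩ := Finset.mem_powersetCard.1 hS
        rw [rightCount_cons_self (Finset.card_pos.1 (by omega)) hS, leftCount_cons_self hS,
          Nat.choose_succ_succ]
        ring
      · obtain rfl : d = !s := by cases d <;> cases s <;> simp_all
        obtain ⟨b, rfl⟩ := Nat.exists_eq_succ_of_ne_zero hb.ne'
        rw [if_neg (by simp), positions_cons_self,
          sum_powersetCard_insert (length_notMem_positions _ _)]
        simp [rightCount_cons_not, rightCount_insert_length, leftCount_cons_not,
          leftCount_insert_length]

theorem numOcc_two_blocks (s : Bool) (a : ℕ) {b : ℕ} (hb : 0 < b) (w : BinaryWord) :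
    numOcc (List.replicate a s ++ List.replicate b (!s)) w =
      ∑ S ∈ (positions (!s) w).powersetCard b, (leftCount s w S).choose a := by
  simpa using numOcc_three_blocks s a hb 0 w

theorem rightCount_le_singleton (s : Bool) (w : BinaryWord) {S : Finset ℕ} {i : ℕ} (hi : i ∈ S) :
    rightCount s w S ≤ rightCount s w {i} :=
  Finset.card_le_card fun k hk => by
    simp only [Finset.mem_filter, Finset.mem_singleton, forall_eq] at hk ⊢
    exact ⟨hk.1, hk.2 i hi⟩

theorem leftCount_le_singleton (s : Bool) (w : BinaryWord) {S : Finset ℕ} {i : ℕ} (hi : i ∈ S) :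
    leftCount s w S ≤ leftCount s w {i} :=
  Finset.card_le_card fun k hk => by
    simp only [Finset.mem_filter, Finset.mem_singleton, forall_eq] at hk ⊢
    exact ⟨hk.1, hk.2 i hi⟩

theorem exists_rightCount_eq_singleton (s : Bool) (w : BinaryWord) {S : Finset ℕ}
    (hS : S.Nonempty) : ∃ i ∈ S, rightCount s w S = rightCount s w {i} := by
  refine ⟨S.min' hS, S.min'_mem hS, le_antisymm (rightCount_le_singleton s w (S.min'_mem hS)) ?_⟩
  refine Finset.card_le_card fun k hk => ?_
  simp only [Finset.mem_filter, Finset.mem_singleton, forall_eq] at hk ⊢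
  exact ⟨hk.1, fun i hi => hk.2.trans_le (S.min'_le i hi)⟩

theorem exists_leftCount_eq_singleton (s : Bool) (w : BinaryWord) {S : Finset ℕ}
    (hS : S.Nonempty) : ∃ i ∈ S, leftCount s w S = leftCount s w {i} := by
  refine ⟨S.max' hS, S.max'_mem hS, le_antisymm (leftCount_le_singleton s w (S.max'_mem hS)) ?_⟩
  refine Finset.card_le_card fun k hk => ?_
  simp only [Finset.mem_filter, Finset.mem_singleton, forall_eq] at hk ⊢
  exact ⟨hk.1, fun i hi => (S.le_max' i hi).trans_lt hk.2⟩

theorem disjoint_positions (s : Bool) (w : BinaryWord) {i : ℕ} (hi : i ∈ positions (!s) w) :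
    i ∉ positions s w := by
  induction w with
  | nil => simp [positions] at hi
  | cons d w ih =>
    by_cases hd : d = s
    · subst hd
      rw [positions_not_cons] at hi
      rw [positions_cons_self, Finset.mem_insert, not_or]
      exact ⟨(lt_length_of_mem_positions hi).ne, ih hi⟩
    · obtain rfl : d = !s := by cases d <;> cases s <;> simp_all
      rw [positions_cons_self, Finset.mem_insert] at hi
      rw [positions_cons_not]
      rcases hi with rfl | hi
      · exact length_notMem_positions _ _
      · exact ih hi

theorem leftCount_add_rightCount_singleton (s : Bool) (w : BinaryWord) {i : ℕ}
    (hi : i ∈ positions (!s) w) :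
    leftCount s w {i} + rightCount s w {i} = w.count s := by
  rw [← card_positions, leftCount, rightCount, add_comm,
    ← Finset.card_filter_add_card_filter_not (s := positions s w) (fun k => k < i)]
  congr 2
  · simp
  · refine Finset.filter_congr fun k hk => ?_
    have : k ≠ i := fun h => disjoint_positions s w hi (h ▸ hk)
    simp only [Finset.mem_singleton, forall_eq]
    omega

theorem positions_not_replicate_append (s : Bool) (i : ℕ) (w : BinaryWord) :
    positions (!s) (List.replicate i s ++ w) = positions (!s) w := by
  induction i with
  | zero => rfl
  | succ i ih => rw [List.replicate_succ, List.cons_append, positions_not_cons, ih]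

theorem rightCount_replicate_append {s : Bool} (i : ℕ) {w : BinaryWord} {S : Finset ℕ}
    (hne : S.Nonempty) (hS : S ⊆ positions (!s) w) :
    rightCount s (List.replicate i s ++ w) S = rightCount s w S := by
  induction i with
  | zero => rfl
  | succ i ih =>
    rw [List.replicate_succ, List.cons_append, rightCount_cons_self hne, ih]
    rwa [positions_not_replicate_append]

theorem leftCount_replicate_append {s : Bool} (i : ℕ) {w : BinaryWord} {S : Finset ℕ}
    (hS : S ⊆ positions (!s) w) :
    leftCount s (List.replicate i s ++ w) S = leftCount s w S + i := by
  induction i with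
  | zero => rfl
  | succ i ih =>
    rw [List.replicate_succ, List.cons_append, leftCount_cons_self, ih, add_assoc]
    rwa [positions_not_replicate_append]

theorem le_of_mem_positions_replicate (s : Bool) (m j : ℕ) {k : ℕ}
    (h : k ∈ positions (!s) (List.replicate m (!s) ++ List.replicate j s)) : j ≤ k := by
  induction m with
  | zero =>
    have := positions_not_replicate_append s j []
    rw [List.append_nil] at this
    simp [this, positions] at h
  | succ m ih =>
    rw [List.replicate_succ, List.cons_append, positions_cons_self, Finset.mem_insert] at h
    rcases h with rfl | h
    · simp
    · exact ih h

theorem positions_replicate_not_append (s : Bool) (m : ℕ) (w : BinaryWord) :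
    positions s (List.replicate m (!s) ++ w) = positions s w := by
  simpa using positions_not_replicate_append (!s) m w

/-- The word `s ^ i t ^ m s ^ j` has `C(i, a) C(m, b) C(j, c)` occurrences of
`s ^ a t ^ b s ^ c`. -/
theorem numOcc_three_blocks_blocks (s : Bool) (a : ℕ) {b : ℕ} (hb : 0 < b) (c i m j : ℕ) :
    numOcc (List.replicate a s ++ (List.replicate b (!s) ++ List.replicate c s))
      (List.replicate i s ++ (List.replicate m (!s) ++ List.replicate j s)) =
      i.choose a * m.choose b * j.choose c := by
  rw [numOcc_three_blocks s a hb, positions_not_replicate_append]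
  have h : ∀ S ∈ (positions (!s) (List.replicate m (!s) ++ List.replicate j s)).powersetCard b,
      (leftCount s (List.replicate i s ++ (List.replicate m (!s) ++ List.replicate j s))
        S).choose a * (rightCount s (List.replicate i s ++ (List.replicate m (!s) ++
        List.replicate j s)) S).choose c = i.choose a * j.choose c := by
    intro S hS
    obtain ⟨hS, hc⟩ := Finset.mem_powersetCard.1 hS
    have hne : S.Nonempty := Finset.card_pos.1 (by omega)
    rw [leftCount_replicate_append _ hS, rightCount_replicate_append _ hne hS]
    have hlt : ∀ k ∈ positions s (List.replicate j s), ∀ i ∈ S, k < i := fun k hk i hi => by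
      have h1 := lt_length_of_mem_positions hk
      have h2 := le_of_mem_positions_replicate s m j (hS hi)
      rw [List.length_replicate] at h1
      omega
    have hl : leftCount s (List.replicate m (!s) ++ List.replicate j s) S = 0 := by
      rw [leftCount, positions_replicate_not_append, Finset.card_eq_zero,
        Finset.filter_eq_empty_iff]
      intro k hk h
      obtain ⟨i, hi⟩ := hne
      exact absurd (h i hi) (hlt k hk i hi).not_gt
    have hr : rightCount s (List.replicate m (!s) ++ List.replicate j s) S = j := by
      rw [rightCount, positions_replicate_not_append, Finset.filter_true_of_mem hlt,
        card_positions, List.count_replicate_self]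
    rw [hl, hr, zero_add]
  rw [Finset.sum_congr rfl h, Finset.sum_const, Finset.card_powersetCard, card_positions,
    List.count_append, List.count_replicate_self, List.count_replicate, smul_eq_mul]
  simp
  ring

theorem numOcc_two_blocks_blocks (s : Bool) (a : ℕ) {b : ℕ} (hb : 0 < b) (i m : ℕ) :
    numOcc (List.replicate a s ++ List.replicate b (!s))
      (List.replicate i s ++ List.replicate m (!s)) = i.choose a * m.choose b := by
  simpa using numOcc_three_blocks_blocks s a hb 0 i m 0

/-! ### Products of binomial coefficients with a given sum of the upper entries -/

theorem le_choose_of_lt {n k : ℕ} (hk : 0 < k) (hkn : k < n) : n ≤ n.choose k := by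
  induction n with
  | zero => exact absurd hkn (Nat.not_lt_zero _)
  | succ n ih =>
    obtain ⟨k, rfl⟩ := Nat.exists_eq_succ_of_ne_zero hk.ne'
    rcases Nat.lt_succ_iff_lt_or_eq.1 hkn with h | rfl
    · have h1 := ih h
      have h2 : 0 < n.choose k := Nat.choose_pos (by omega)
      rw [Nat.choose_succ_succ]
      omega
    · simp [Nat.choose_succ_self_right]

theorem le_of_choose_pos {n k : ℕ} (h : 0 < n.choose k) : k ≤ n := by
  by_contra hlt
  rw [Nat.choose_eq_zero_of_lt (not_le.1 hlt)] at h
  exact absurd h (lt_irrefl 0)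

theorem eq_of_choose_eq_one {n k : ℕ} (hk : 0 < k) (h : n.choose k = 1) : n = k := by
  have h1 : k ≤ n := le_of_choose_pos (by omega)
  by_contra hne
  have := le_choose_of_lt hk (lt_of_le_of_ne h1 (Ne.symm hne))
  omega

theorem choose_lt_choose_left {m n k : ℕ} (hk : 0 < k) (hkn : k ≤ n) (hmn : m < n) :
    m.choose k < n.choose k := by
  obtain ⟨n, rfl⟩ := Nat.exists_eq_succ_of_ne_zero (by omega : n ≠ 0)
  obtain ⟨k, rfl⟩ := Nat.exists_eq_succ_of_ne_zero hk.ne'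
  have h1 : m.choose k.succ ≤ n.choose k.succ := Nat.choose_le_choose _ (by omega)
  have h2 : 0 < n.choose k := Nat.choose_pos (by omega)
  rw [Nat.choose_succ_succ]
  omega

/-- Log-concavity of `n ↦ C(n, a)`. -/
theorem choose_succ_mul_choose_le {x y : ℕ} (a : ℕ) (h : x ≤ y) :
    (y + 1).choose a * x.choose a ≤ (x + 1).choose a * y.choose a := by
  rcases lt_or_ge x a with hxa | hxa
  · rw [Nat.choose_eq_zero_of_lt hxa, mul_zero]
    exact Nat.zero_le _
  · have hx := Nat.choose_mul_succ_eq x a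
    have hy := Nat.choose_mul_succ_eq y a
    obtain ⟨x, rfl⟩ := Nat.exists_eq_add_of_le hxa
    obtain ⟨y, rfl⟩ := Nat.exists_eq_add_of_le (hxa.trans h)
    rw [show a + x + 1 - a = x + 1 by omega] at hx
    rw [show a + y + 1 - a = y + 1 by omega] at hy
    refine Nat.le_of_mul_le_mul_right (c := (x + 1) * (y + 1)) ?_ (by positivity)
    calc (a + y + 1).choose a * (a + x).choose a * ((x + 1) * (y + 1))
        = ((a + y + 1).choose a * (y + 1)) * ((a + x).choose a * (x + 1)) := by ring
      _ = ((a + y).choose a * (a + x).choose a) * ((a + y + 1) * (x + 1)) := by rw [← hy]; ring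
      _ ≤ ((a + y).choose a * (a + x).choose a) * ((a + x + 1) * (y + 1)) := by
          refine Nat.mul_le_mul_left _ ?_
          have : x ≤ y := by omega
          nlinarith [Nat.mul_le_mul_left a this]
      _ = ((a + x).choose a * (a + x + 1)) * ((a + y).choose a * (y + 1)) := by ring
      _ = (a + x + 1).choose a * (a + y).choose a * ((x + 1) * (y + 1)) := by rw [hx]; ring

/-- A log-concave sequence lies below the geometric sequence of ratio `l` through its value at `v`
if it does so at `v - 1` and at `v + 1`. -/
theorem choose_mul_pow_le {a v : ℕ} {l : ℝ} (hl : 0 < l) (hv : a ≤ v)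
    (hup : ((v + 1).choose a : ℝ) ≤ l * v.choose a)
    (hdown : l * ((v - 1).choose a : ℝ) ≤ v.choose a) (t : ℕ) :
    (t.choose a : ℝ) * l ^ v ≤ v.choose a * l ^ t := by
  have hpos : (0 : ℝ) < v.choose a := by exact_mod_cast Nat.choose_pos hv
  rcases le_total v t with h | h
  · induction t, h using Nat.le_induction with
    | base => exact le_rfl
    | succ t ht ih =>
      have h1 : ((t + 1).choose a : ℝ) * v.choose a ≤ (v + 1).choose a * t.choose a := by
        exact_mod_cast choose_succ_mul_choose_le a ht
      have h2 : ((t + 1).choose a : ℝ) ≤ l * t.choose a := by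
        refine le_of_mul_le_mul_right ?_ hpos
        calc ((t + 1).choose a : ℝ) * v.choose a ≤ (v + 1).choose a * t.choose a := h1
          _ ≤ (l * v.choose a) * t.choose a := by gcongr
          _ = l * t.choose a * v.choose a := by ring
      calc ((t + 1).choose a : ℝ) * l ^ v ≤ l * t.choose a * l ^ v := by gcongr
        _ = l * (t.choose a * l ^ v) := by ring
        _ ≤ l * (v.choose a * l ^ t) := by gcongr
        _ = v.choose a * l ^ (t + 1) := by ring
  · refine Nat.decreasingInduction
      (motive := fun t _ => (t.choose a : ℝ) * l ^ v ≤ v.choose a * l ^ t) ?_ le_rfl h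
    · intro t ht ih
      have h1 : (v.choose a : ℝ) * t.choose a ≤ (t + 1).choose a * (v - 1).choose a := by
        have := choose_succ_mul_choose_le a (show t ≤ v - 1 by omega)
        rw [Nat.sub_add_cancel (by omega)] at this
        exact_mod_cast this
      have h2 : l * t.choose a ≤ ((t + 1).choose a : ℝ) := by
        refine le_of_mul_le_mul_right ?_ hpos
        calc l * t.choose a * (v.choose a : ℝ) = l * (v.choose a * t.choose a) := by ring
          _ ≤ l * ((t + 1).choose a * (v - 1).choose a) := by gcongr
          _ = (t + 1).choose a * (l * (v - 1).choose a) := by ring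
          _ ≤ (t + 1).choose a * v.choose a := by gcongr
      refine le_of_mul_le_mul_left ?_ hl
      calc l * (t.choose a * l ^ v) = l * t.choose a * l ^ v := by ring
        _ ≤ (t + 1).choose a * l ^ v := by gcongr
        _ ≤ v.choose a * l ^ (t + 1) := ih
        _ = l * (v.choose a * l ^ t) := by ring

/-- For the product `∏ p, C(v p, a p)` under the constraint that `∑ p, v p` is fixed, a local
maximum with respect to moving one unit between two coordinates is a global maximum. The largest
ratio `C(v p + 1, a p) / C(v p, a p)` is a Lagrange multiplier: by log-concavity every single factor
satisfies `C(t, a p) ≤ C(v p, a p) * l ^ (t - v p)`. -/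
theorem prod_choose_le_of_forall_exchange_le {ι : Type*} [Fintype ι] [Nonempty ι] {a v u : ι → ℕ}
    (hv : ∀ p, a p ≤ v p) (hsum : ∑ p, u p = ∑ p, v p)
    (hloc : ∀ p q, p ≠ q → (v p + 1).choose (a p) * (v q - 1).choose (a q) ≤
      (v p).choose (a p) * (v q).choose (a q)) :
    ∏ p, (u p).choose (a p) ≤ ∏ p, (v p).choose (a p) := by
  obtain ⟨p₀, -, hp₀⟩ := Finset.exists_max_image Finset.univ
    (fun p => ((v p + 1).choose (a p) : ℝ) / (v p).choose (a p)) Finset.univ_nonempty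
  have hpos : ∀ p, (0 : ℝ) < (v p).choose (a p) := fun p => by
    exact_mod_cast Nat.choose_pos (hv p)
  set l : ℝ := ((v p₀ + 1).choose (a p₀) : ℝ) / (v p₀).choose (a p₀) with hl
  have hl0 : 0 < l :=
    div_pos (by exact_mod_cast Nat.choose_pos ((hv p₀).trans (Nat.le_succ _))) (hpos p₀)
  have key : ∀ p, ((u p).choose (a p) : ℝ) * l ^ v p ≤ (v p).choose (a p) * l ^ u p := by
    intro p
    refine choose_mul_pow_le hl0 (hv p) ?_ ?_ (u p)
    · exact (div_le_iff₀ (hpos p)).1 (hp₀ p (Finset.mem_univ _))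
    · rw [hl, div_mul_eq_mul_div, div_le_iff₀ (hpos p₀)]
      by_cases hp : p₀ = p
      · subst hp
        rcases Nat.eq_zero_or_pos (v p₀) with h0 | h0
        · have : a p₀ = 0 := by have := hv p₀; omega
          simp [this]
        · have := choose_succ_mul_choose_le (a p₀) (show v p₀ - 1 ≤ v p₀ by omega)
          rw [Nat.sub_add_cancel h0] at this
          exact_mod_cast this
      · have := hloc p₀ p hp
        rw [mul_comm ((v p₀).choose (a p₀))] at this
        exact_mod_cast this
  have hprod := Finset.prod_le_prod (s := Finset.univ)
    (fun p _ => mul_nonneg (Nat.cast_nonneg _) (pow_nonneg hl0.le _)) (fun p _ => key p)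
  rw [Finset.prod_mul_distrib, Finset.prod_mul_distrib, Finset.prod_pow_eq_pow_sum,
    Finset.prod_pow_eq_pow_sum, hsum] at hprod
  have := le_of_mul_le_mul_right hprod (pow_pos hl0 _)
  exact_mod_cast this

theorem choose_mul_choose_sub (a b x y : ℕ) (ha : 0 < a) (hb : 0 < b) (hx : a ≤ x) (hy : b ≤ y) :
    (a * b : ℤ) * ((x + 1).choose a * y.choose b - x.choose a * (y + 1).choose b) =
      x.choose (a - 1) * y.choose (b - 1) * (a * (y + 1) - b * (x + 1)) := by
  obtain ⟨a, rfl⟩ := Nat.exists_eq_succ_of_ne_zero ha.ne'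
  obtain ⟨b, rfl⟩ := Nat.exists_eq_succ_of_ne_zero hb.ne'
  have h1 : (x.choose (a + 1) * (a + 1) : ℤ) = x.choose a * (x - a) := by
    have := Nat.choose_succ_right_eq x a
    zify [show a ≤ x by omega] at this
    exact this
  have h2 : (y.choose (b + 1) * (b + 1) : ℤ) = y.choose b * (y - b) := by
    have := Nat.choose_succ_right_eq y b
    zify [show b ≤ y by omega] at this
    exact this
  rw [Nat.choose_succ_succ, Nat.choose_succ_succ y b]
  simp only [Nat.succ_eq_add_one, Nat.add_sub_cancel]
  push_cast
  linear_combination ((a + 1 : ℤ) * x.choose a) * h2 - ((b + 1 : ℤ) * y.choose b) * h1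

/-- Moving one unit never changes `C(x, a) C(y, b)` by exactly one, unless `a = b = 1` or the
entries are too small. -/
theorem choose_mul_choose_succ_ne_add_one {a b x y : ℕ} (ha : 0 < a) (hb : 0 < b)
    (hab : 3 ≤ a + b) (hx : a ≤ x) (hy : b ≤ y) (hxy : a + b + 1 ≤ x + y) :
    (x + 1).choose a * y.choose b ≠ x.choose a * (y + 1).choose b + 1 ∧
    x.choose a * (y + 1).choose b ≠ (x + 1).choose a * y.choose b + 1 := by
  have key : ∀ e : ℤ, |e| = 1 →
      ((x + 1).choose a * y.choose b - x.choose a * (y + 1).choose b : ℤ) ≠ e := by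
    intro e he h
    have hid := choose_mul_choose_sub a b x y ha hb hx hy
    rw [h] at hid
    have habs := congrArg abs hid
    set d : ℤ := |(a * (y + 1) - b * (x + 1) : ℤ)| with hd
    have hd0 : 0 ≤ d := abs_nonneg _
    have e1 : |(a * b : ℤ)| = a * b := abs_of_nonneg (by positivity)
    have e2 : |(x.choose (a - 1) * y.choose (b - 1) : ℤ)| = x.choose (a - 1) * y.choose (b - 1) :=
      abs_of_nonneg (by positivity)
    rw [abs_mul, he, mul_one, e1, abs_mul, e2, ← hd] at habs
    have hd1 : 1 ≤ d := by
      by_contra hlt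
      have : d = 0 := by omega
      rw [this, mul_zero] at habs
      have : 0 < (a * b : ℤ) := by positivity
      omega
    have hle : x.choose (a - 1) * y.choose (b - 1) ≤ a * b := by
      zify
      rw [habs]
      exact le_mul_of_one_le_right (by positivity) hd1
    have hA : 1 < a → x ≤ x.choose (a - 1) := fun h => le_choose_of_lt (by omega) (by omega)
    have hB : 1 < b → y ≤ y.choose (b - 1) := fun h => le_choose_of_lt (by omega) (by omega)
    rcases Nat.lt_or_ge 1 a with h1a | h1a <;> rcases Nat.lt_or_ge 1 b with h1b | h1b
    · have h1 := (Nat.mul_le_mul (hA h1a) (hB h1b)).trans hle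
      rcases Nat.lt_or_ge a x with h2 | h2
      · nlinarith [Nat.mul_le_mul_right b (Nat.succ_le_of_lt h2), Nat.mul_le_mul_left x hy]
      · nlinarith [Nat.mul_le_mul_left a (show b + 1 ≤ y by omega), Nat.mul_le_mul_right y hx]
    · obtain rfl : b = 1 := by omega
      have hxa := hA h1a
      simp only [Nat.sub_self, Nat.choose_zero_right, mul_one] at hle
      obtain rfl : x = a := by omega
      have hA' : x.choose (x - 1) = x := by
        have := Nat.choose_succ_self_right (x - 1)
        rwa [Nat.sub_add_cancel ha] at this
      rw [hA'] at habs
      simp only [Nat.sub_self, Nat.choose_zero_right, Nat.cast_one, mul_one] at habs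
      have hd' : d = 1 := by
        have : (0 : ℤ) < x := by exact_mod_cast ha
        exact mul_left_cancel₀ this.ne' (by linarith)
      have hx2 : (2 : ℤ) ≤ x := by omega
      have hy2 : (2 : ℤ) ≤ y := by omega
      have hxy4 : (2 * 2 : ℤ) ≤ x * y := mul_le_mul hx2 hy2 (by norm_num) (by positivity)
      rw [hd] at hd'
      rcases abs_eq_abs.1 (hd'.trans abs_one.symm) with h5 | h5 <;> push_cast at h5 <;> linarith
    · obtain rfl : a = 1 := by omega
      have hyb := hB h1b
      simp only [Nat.sub_self, Nat.choose_zero_right, one_mul] at hle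
      obtain rfl : y = b := by omega
      have hB' : y.choose (y - 1) = y := by
        have := Nat.choose_succ_self_right (y - 1)
        rwa [Nat.sub_add_cancel hb] at this
      rw [hB'] at habs
      simp only [Nat.sub_self, Nat.choose_zero_right, Nat.cast_one, one_mul] at habs
      have hd' : d = 1 := by
        have : (0 : ℤ) < y := by exact_mod_cast hb
        exact mul_left_cancel₀ this.ne' (by linarith)
      have hx2 : (2 : ℤ) ≤ x := by omega
      have hy2 : (2 : ℤ) ≤ y := by omega
      have hxy4 : (2 * 2 : ℤ) ≤ x * y := mul_le_mul hx2 hy2 (by norm_num) (by positivity)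
      rw [hd] at hd'
      rcases abs_eq_abs.1 (hd'.trans abs_one.symm) with h5 | h5 <;> push_cast at h5 <;> linarith
    · omega
  constructor
  · intro h
    refine key 1 (by simp) ?_
    zify at h
    linarith
  · intro h
    refine key (-1) (by simp) ?_
    zify at h
    linarith

theorem exists_exchange_of_choose_mul_choose_lt {a b x y x' y' : ℕ} (hx : a ≤ x) (hy : b ≤ y)
    (hsum : x' + y' = x + y)
    (hlt : x.choose a * y.choose b < x'.choose a * y'.choose b) :
    x.choose a * y.choose b < (x + 1).choose a * (y - 1).choose b ∨
    x.choose a * y.choose b < (x - 1).choose a * (y + 1).choose b := by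
  by_contra! h
  refine absurd (prod_choose_le_of_forall_exchange_le (a := ![a, b]) (v := ![x, y])
    (u := ![x', y']) ?_ ?_ ?_) ?_
  · simp [Fin.forall_fin_two, hx, hy]
  · simpa using hsum
  · simp only [Fin.forall_fin_two]
    simp
    exact ⟨h.1, by linarith [h.2]⟩
  · simpa using hlt

theorem exists_exchange_of_three_choose_lt {a b c i m j i' m' j' : ℕ} (hi : a ≤ i) (hm : b ≤ m)
    (hj : c ≤ j) (hsum : i' + m' + j' = i + m + j)
    (hlt : i.choose a * m.choose b * j.choose c < i'.choose a * m'.choose b * j'.choose c) :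
    i.choose a * m.choose b < (i + 1).choose a * (m - 1).choose b ∨
    i.choose a * j.choose c < (i + 1).choose a * (j - 1).choose c ∨
    m.choose b * i.choose a < (m + 1).choose b * (i - 1).choose a ∨
    m.choose b * j.choose c < (m + 1).choose b * (j - 1).choose c ∨
    j.choose c * i.choose a < (j + 1).choose c * (i - 1).choose a ∨
    j.choose c * m.choose b < (j + 1).choose c * (m - 1).choose b := by
  by_contra! h
  refine absurd (prod_choose_le_of_forall_exchange_le (a := ![a, b, c]) (v := ![i, m, j])
    (u := ![i', m', j']) ?_ ?_ ?_) ?_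
  · simp [Fin.forall_fin_succ, hi, hm, hj]
  · simpa [Fin.sum_univ_three] using hsum
  · obtain ⟨h1, h2, h3, h4, h5, h6⟩ := h
    intro p q hpq
    fin_cases p <;> fin_cases q <;> first | exact absurd rfl hpq | assumption
  · simpa [Fin.prod_univ_three] using hlt

/-- The second largest value of `C(x, a) C(y, b)` with `x + y` fixed is not the largest value
minus one. -/
theorem two_choose_add_one_ne {a b n M : ℕ} (ha : 0 < a) (hb : 0 < b) (hab : 3 ≤ a + b)
    (hn : a + b + 2 ≤ n) (hM : ∀ x y, x + y = n → x.choose a * y.choose b ≤ M)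
    (hM' : ∃ x y, x + y = n ∧ x.choose a * y.choose b = M) {x y : ℕ} (hxy : x + y = n) :
    x.choose a * y.choose b + 1 ≠ M := by
  intro h
  have hM2 : 2 ≤ M := by
    have h1 := hM a (n - a) (by omega)
    have h2 := le_choose_of_lt hb (show b < n - a by omega)
    rw [Nat.choose_self, one_mul] at h1
    omega
  have hpos : 0 < x.choose a * y.choose b := by omega
  have hxa := le_of_choose_pos (Nat.pos_of_mul_pos_right hpos)
  have hyb := le_of_choose_pos (Nat.pos_of_mul_pos_left hpos)
  obtain ⟨x', y', hxy', h'⟩ := hM'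
  rcases exists_exchange_of_choose_mul_choose_lt hxa hyb (hxy'.trans hxy.symm) (by omega)
    with h1 | h1
  · have hp := hpos.trans h1
    have hyb' := le_of_choose_pos (Nat.pos_of_mul_pos_left hp)
    have h2 := hM (x + 1) (y - 1) (by omega)
    obtain ⟨y, rfl⟩ := Nat.exists_eq_succ_of_ne_zero (show y ≠ 0 by omega)
    simp only [Nat.succ_eq_add_one, Nat.add_sub_cancel] at *
    exact (choose_mul_choose_succ_ne_add_one ha hb hab hxa hyb' (by omega)).1 (by omega)
  · have hp := hpos.trans h1
    have hxa' := le_of_choose_pos (Nat.pos_of_mul_pos_right hp)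
    have h2 := hM (x - 1) (y + 1) (by omega)
    obtain ⟨x, rfl⟩ := Nat.exists_eq_succ_of_ne_zero (show x ≠ 0 by omega)
    simp only [Nat.succ_eq_add_one, Nat.add_sub_cancel] at *
    exact (choose_mul_choose_succ_ne_add_one ha hb hab hxa' hyb (by omega)).2 (by omega)

/-- No exchange between the first two entries improves the value `M - 1` of
`C(x, a) C(y, b) C(r, c)`. -/
theorem three_choose_exchange_false {a b c n M x y r : ℕ} (ha : 0 < a) (hb : 0 < b) (hc : 0 < c)
    (habc : 4 ≤ a + b + c) (hn : a + b + c + 3 ≤ n)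
    (hM : ∀ i m j, i + m + j = n → i.choose a * m.choose b * j.choose c ≤ M) (hM2 : 2 ≤ M)
    (hxyr : x + y + r = n)
    (hlt : x.choose a * y.choose b < (x + 1).choose a * (y - 1).choose b)
    (h : x.choose a * y.choose b * r.choose c + 1 = M) : False := by
  have hpos : 0 < x.choose a * y.choose b * r.choose c := by omega
  have hposr := Nat.pos_of_mul_pos_left hpos
  have hpos := Nat.pos_of_mul_pos_right hpos
  have hxa := le_of_choose_pos (Nat.pos_of_mul_pos_right hpos)
  have hyb := le_of_choose_pos (Nat.pos_of_mul_pos_left (hpos.trans hlt))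
  obtain ⟨y, rfl⟩ := Nat.exists_eq_succ_of_ne_zero
    (show y ≠ 0 by have := le_of_choose_pos (Nat.pos_of_mul_pos_left hpos); omega)
  simp only [Nat.succ_eq_add_one, Nat.add_sub_cancel] at *
  have h1 := hM (x + 1) y r (by omega)
  -- the common factor `C(r, c)` divides `M` and `M - 1`
  have h2 := Nat.mul_le_mul_right (r.choose c) (Nat.succ_le_of_lt hlt)
  rw [Nat.succ_eq_add_one, add_mul, one_mul] at h2
  have hr1 : r.choose c = 1 := by omega
  obtain rfl := eq_of_choose_eq_one hc hr1
  rw [hr1, mul_one] at h h1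
  have heq : (x + 1).choose a * y.choose b = x.choose a * (y + 1).choose b + 1 := by omega
  rcases Nat.lt_or_ge 2 (a + b) with hab | hab
  · exact (choose_mul_choose_succ_ne_add_one ha hb hab hxa hyb (by omega)).1 heq
  · obtain rfl : a = 1 := by omega
    obtain rfl : b = 1 := by omega
    simp only [Nat.choose_one_right] at heq h
    obtain rfl : y = x + 1 := by nlinarith
    have h3 := hM x (x + 1) (r + 1) (by omega)
    simp only [Nat.choose_one_right, Nat.choose_succ_self_right] at h3
    have hr2 : 2 ≤ r := by omega
    have hx2 : 2 ≤ x := by omega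
    nlinarith [Nat.mul_le_mul_left (x * (x + 1)) (show 3 ≤ r + 1 by omega)]

/-- The second largest value of `C(i, a) C(m, b) C(j, c)` with `i + m + j` fixed is not the largest
value minus one: an improving exchange leaves one factor unchanged, and this factor then divides
two consecutive integers. -/
theorem three_choose_add_one_ne {a b c n M : ℕ} (ha : 0 < a) (hb : 0 < b) (hc : 0 < c)
    (habc : 4 ≤ a + b + c) (hn : a + b + c + 3 ≤ n)
    (hM : ∀ i m j, i + m + j = n → i.choose a * m.choose b * j.choose c ≤ M)
    (hM' : ∃ i m j, i + m + j = n ∧ i.choose a * m.choose b * j.choose c = M)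
    (hM2 : 2 ≤ M) {i m j : ℕ} (hsum : i + m + j = n) :
    i.choose a * m.choose b * j.choose c + 1 ≠ M := by
  intro h
  have hpos : 0 < i.choose a * m.choose b * j.choose c := by omega
  have hj := le_of_choose_pos (Nat.pos_of_mul_pos_left hpos)
  have hpos := Nat.pos_of_mul_pos_right hpos
  have hi := le_of_choose_pos (Nat.pos_of_mul_pos_right hpos)
  have hm := le_of_choose_pos (Nat.pos_of_mul_pos_left hpos)
  obtain ⟨i', m', j', hsum', h'⟩ := hM'
  rcases exists_exchange_of_three_choose_lt hi hm hj (hsum'.trans hsum.symm) (by omega)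
    with h1 | h1 | h1 | h1 | h1 | h1
  · exact three_choose_exchange_false ha hb hc habc hn hM hM2 hsum h1 h
  · exact three_choose_exchange_false (n := n) (r := m) ha hc hb (by omega) (by omega)
      (fun x y z h => by rw [mul_right_comm]; exact hM x z y (by omega)) hM2 (by omega) h1
      (by rw [mul_right_comm]; exact h)
  · exact three_choose_exchange_false (n := n) (r := j) hb ha hc (by omega) (by omega)
      (fun x y z h => by rw [mul_comm (x.choose b)]; exact hM y x z (by omega)) hM2 (by omega) h1
      (by rw [mul_comm (m.choose b)]; exact h)
  · exact three_choose_exchange_false (n := n) (r := i) hb hc ha (by omega) (by omega)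
      (fun x y z h => by rw [mul_comm, ← mul_assoc]; exact hM z x y (by omega)) hM2 (by omega) h1
      (by rw [mul_comm _ (i.choose a), ← mul_assoc]; exact h)
  · exact three_choose_exchange_false (n := n) (r := m) hc ha hb (by omega) (by omega)
      (fun x y z h => by
        rw [mul_comm (x.choose c), mul_right_comm]; exact hM y z x (by omega)) hM2 (by omega) h1
      (by rw [mul_comm (j.choose c), mul_right_comm]; exact h)
  · exact three_choose_exchange_false (n := n) (r := i) hc hb ha (by omega) (by omega)
      (fun x y z h => by
        rw [mul_comm, mul_comm (x.choose c), ← mul_assoc]; exact hM z y x (by omega)) hM2 (by omega)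
      h1 (by rw [mul_comm, mul_comm (j.choose c), ← mul_assoc]; exact h)

/-! ### The maximal number of occurrences -/

theorem numOcc_le_maxOcc (p : BinaryWord) {w : BinaryWord} {n : ℕ} (h : w.length = n) :
    numOcc p w ≤ maxOcc n p :=
  (isGreatest_maxOcc n p).2 ⟨w, h, rfl⟩

theorem exists_numOcc_eq_maxOcc (n : ℕ) (p : BinaryWord) :
    ∃ w : BinaryWord, w.length = n ∧ numOcc p w = maxOcc n p :=
  (isGreatest_maxOcc n p).1

theorem countWords_eq_zero_iff {n : ℕ} {p : BinaryWord} {k : ℕ} :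
    countWords n p k = 0 ↔ ∀ w : BinaryWord, w.length = n → numOcc p w ≠ k := by
  rw [countWords, Set.ncard_eq_zero ((List.finite_length_eq Bool n).subset fun w hw => hw.1),
    Set.eq_empty_iff_forall_notMem]
  simp

theorem countWords_ne_zero_iff {n : ℕ} {p : BinaryWord} {k : ℕ} :
    countWords n p k ≠ 0 ↔ ∃ w : BinaryWord, w.length = n ∧ numOcc p w = k := by
  rw [Ne, countWords_eq_zero_iff]
  push Not
  rfl

theorem numOcc_cons_replicate_not (s : Bool) (p : BinaryWord) (n : ℕ) :
    numOcc (s :: p) (List.replicate n (!s)) = 0 := by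
  induction n with
  | zero => exact numOcc_cons_nil _ _
  | succ n ih => rw [List.replicate_succ, numOcc_cons_cons, ih, if_neg (by simp)]

/-- If `M_{n,p} ≥ 2` and the value `M_{n,p} - 1` is not taken, then it is an internal zero, since
the value `0` is taken. -/
theorem hasInternalZero_of_add_one_ne {p : BinaryWord} {n : ℕ} (h2 : 2 ≤ maxOcc n p)
    (h : ∀ w : BinaryWord, w.length = n → numOcc p w + 1 ≠ maxOcc n p) :
    HasInternalZero (countWords n p) ∧ countWords n p (maxOcc n p - 1) = 0 := by
  have h0 : countWords n p (maxOcc n p - 1) = 0 :=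
    countWords_eq_zero_iff.2 fun w hw hk => h w hw (by omega)
  refine ⟨⟨0, maxOcc n p - 1, maxOcc n p, by omega, by omega, ?_, h0,
    countWords_ne_zero_iff.2 (exists_numOcc_eq_maxOcc n p)⟩, h0⟩
  rw [countWords_ne_zero_iff]
  cases p with
  | nil =>
    obtain ⟨w, -, hw⟩ := exists_numOcc_eq_maxOcc n []
    rw [numOcc_nil_left] at hw
    omega
  | cons s p => exact ⟨List.replicate n (!s), by simp, numOcc_cons_replicate_not s p n⟩

/-- A sum of natural numbers bounded by `g` that misses its trivial upper bound by exactly one has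
exactly one term different from `g`. -/
theorem exists_deficit_of_sum_add_one {ι : Type*} {P : Finset ι} {f : ι → ℕ} {g : ℕ}
    (hf : ∀ x ∈ P, f x ≤ g) (h : ∑ x ∈ P, f x + 1 = P.card * g) :
    ∃ x₀ ∈ P, f x₀ + 1 = g ∧ ∀ x ∈ P, f x < g → x = x₀ := by
  classical
  have h1 : ∑ x ∈ P, (g - f x) = 1 := by
    have : ∑ x ∈ P, (g - f x) + ∑ x ∈ P, f x = P.card * g := by
      rw [← Finset.sum_add_distrib, ← smul_eq_mul, ← Finset.sum_const]
      exact Finset.sum_congr rfl fun x hx => Nat.sub_add_cancel (hf x hx)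
    omega
  obtain ⟨x₀, hx₀, hne⟩ := Finset.exists_ne_zero_of_sum_ne_zero (h1.trans_ne one_ne_zero)
  have h2 := Finset.add_sum_erase P (fun x => g - f x) hx₀
  refine ⟨x₀, hx₀, by omega, fun x hx hlt => ?_⟩
  by_contra hxx
  have h3 : g - f x ≤ ∑ x ∈ P.erase x₀, (g - f x) :=
    Finset.single_le_sum (f := fun x => g - f x) (fun _ _ => Nat.zero_le _)
      (Finset.mem_erase.2 ⟨hxx, hx⟩)
  omega

/-! ### Words with one run or two runs -/

/-- The value `M - 1` is not taken: `C(n, l)` and `C(n - 1, l)` are too far apart. -/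
theorem one_block_gap (s : Bool) {l n : ℕ} (hl : 2 ≤ l) (hn : l + 3 ≤ n) :
    2 ≤ maxOcc n (List.replicate l s) ∧ ∀ w : BinaryWord, w.length = n →
      numOcc (List.replicate l s) w + 1 ≠ maxOcc n (List.replicate l s) := by
  have hM : n.choose l ≤ maxOcc n (List.replicate l s) := by
    have := numOcc_le_maxOcc (List.replicate l s) (List.length_replicate (n := n) (a := s))
    rwa [numOcc_replicate, List.count_replicate_self] at this
  have h1 : n ≤ n.choose l := le_choose_of_lt (by omega) (by omega)
  refine ⟨by omega, fun w hw h => ?_⟩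
  rw [numOcc_replicate] at h
  have hz : w.count s ≤ n := hw ▸ List.count_le_length
  rcases hz.lt_or_eq with hz | hz
  · have h2 : (w.count s).choose l ≤ (n - 1).choose l := Nat.choose_le_choose _ (by omega)
    have h3 : n - 1 ≤ (n - 1).choose (l - 1) := le_choose_of_lt (by omega) (by omega)
    have h4 := Nat.choose_succ_succ (n - 1) (l - 1)
    rw [Nat.succ_eq_add_one, Nat.succ_eq_add_one, Nat.sub_add_cancel (by omega),
      Nat.sub_add_cancel (by omega)] at h4
    omega
  · obtain ⟨w', hw', hk⟩ := exists_numOcc_eq_maxOcc n (List.replicate l s)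
    rw [numOcc_replicate] at hk
    have : (w'.count s).choose l ≤ n.choose l :=
      Nat.choose_le_choose _ (hw' ▸ List.count_le_length)
    rw [hz] at h
    omega

theorem leftCount_le_count (s : Bool) (w : BinaryWord) (S : Finset ℕ) :
    leftCount s w S ≤ w.count s := by
  rw [← card_positions]
  exact Finset.card_filter_le _ _

/-- The value `M - 1` is not taken by `s ^ a t ^ b`: in a word `w` with this value exactly one
choice of the block `t ^ b` would be deficient, which leaves only words `w` that are far from
maximal. -/
theorem two_blocks_gap (s : Bool) {a b n : ℕ} (ha : 0 < a) (hb : 0 < b) (hab : 3 ≤ a + b)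
    (hn : a + b + 3 ≤ n) :
    2 ≤ maxOcc n (List.replicate a s ++ List.replicate b (!s)) ∧ ∀ w : BinaryWord, w.length = n →
      numOcc (List.replicate a s ++ List.replicate b (!s)) w + 1 ≠
        maxOcc n (List.replicate a s ++ List.replicate b (!s)) := by
  have hblock : ∀ x y, x + y = n → x.choose a * y.choose b ≤
      maxOcc n (List.replicate a s ++ List.replicate b (!s)) := by
    intro x y hxy
    rw [← numOcc_two_blocks_blocks s a hb]
    exact numOcc_le_maxOcc _ (by simp [hxy])
  have hnum := fun w => numOcc_two_blocks s a hb w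
  obtain ⟨w', hw', hmax⟩ := exists_numOcc_eq_maxOcc n (List.replicate a s ++ List.replicate b (!s))
  set p := List.replicate a s ++ List.replicate b (!s)
  set M := maxOcc n p
  have hM2 : 2 ≤ M := by
    have h1 := hblock a (n - a) (by omega)
    have h2 := le_choose_of_lt hb (show b < n - a by omega)
    rw [Nat.choose_self, one_mul] at h1
    omega
  have hterm : ∀ w : BinaryWord, ∀ S ∈ (positions (!s) w).powersetCard b,
      (leftCount s w S).choose a ≤ (w.count s).choose a := fun w S _ =>
    Nat.choose_le_choose _ (leftCount_le_count s w S)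
  have hle : ∀ w : BinaryWord, numOcc p w ≤ (w.count s).choose a * (w.count (!s)).choose b := by
    intro w
    rw [hnum, mul_comm, ← card_positions (!s), ← Finset.card_powersetCard, ← smul_eq_mul]
    exact Finset.sum_le_card_nsmul _ _ _ (hterm w)
  have hatt : ∃ x y, x + y = n ∧ x.choose a * y.choose b = M := by
    have h := count_add_count_not s w'
    exact ⟨_, _, h.trans hw', le_antisymm (hblock _ _ (h.trans hw')) (hmax ▸ hle w')⟩
  refine ⟨hM2, fun w hw h => ?_⟩
  have hlen := (count_add_count_not s w).trans hw
  have h1 := hle w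
  have h2 := hblock _ _ hlen
  have h3 := two_choose_add_one_ne ha hb hab (by omega) hblock hatt hlen
  have h4 : (w.count s).choose a * (w.count (!s)).choose b = M := by omega
  have hI := card_positions (!s) w
  rw [hnum, ← h4, mul_comm, ← card_positions (!s), ← Finset.card_powersetCard] at h
  obtain ⟨S₀, hS₀, hdef, huniq⟩ := exists_deficit_of_sum_add_one (hterm w) h
  have hz : a ≤ w.count s := le_of_choose_pos (Nat.pos_of_mul_pos_right (a := _)
    (b := (w.count (!s)).choose b) (by omega))
  have hm : b ≤ w.count (!s) := le_of_choose_pos (Nat.pos_of_mul_pos_left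
    (a := (w.count s).choose a) (by omega))
  obtain ⟨hS₀I, hS₀c⟩ := Finset.mem_powersetCard.1 hS₀
  obtain ⟨i, hi, hli⟩ := exists_leftCount_eq_singleton s w (S := S₀)
    (Finset.card_pos.1 (by omega))
  have hltz : leftCount s w S₀ < w.count s := by
    refine lt_of_le_of_ne (leftCount_le_count s w S₀) fun heq => ?_
    rw [heq] at hdef
    omega
  -- every choice of the block `t ^ b` through the position `i` is deficient
  have hbm : b = 1 ∨ w.count (!s) = b := by
    by_contra! hcon
    obtain ⟨t, ht, hti⟩ := Finset.exists_mem_ne (show 1 < S₀.card by omega) i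
    obtain ⟨k, hk, hkS⟩ := Finset.exists_mem_notMem_of_card_lt_card
      (show S₀.card < (positions (!s) w).card by omega)
    have hkt : k ∉ S₀.erase t := fun h => hkS (Finset.mem_of_mem_erase h)
    have hS : insert k (S₀.erase t) ∈ (positions (!s) w).powersetCard b := by
      refine Finset.mem_powersetCard.2 ⟨Finset.insert_subset hk
        ((Finset.erase_subset _ _).trans hS₀I), ?_⟩
      rw [Finset.card_insert_of_notMem hkt, Finset.card_erase_of_mem ht]
      omega
    have hiS : i ∈ insert k (S₀.erase t) :=
      Finset.mem_insert_of_mem (Finset.mem_erase.2 ⟨hti.symm, hi⟩)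
    have hlt : (leftCount s w (insert k (S₀.erase t))).choose a < (w.count s).choose a :=
      choose_lt_choose_left ha hz
        ((leftCount_le_singleton s w hiS).trans_lt (hli ▸ hltz))
    exact hkS (huniq _ hS hlt ▸ Finset.mem_insert_self _ _)
  have haz : a = 1 ∨ w.count s = a := by
    have h5 : (leftCount s w S₀).choose a ≤ (w.count s - 1).choose a :=
      Nat.choose_le_choose _ (by omega)
    have h6 := Nat.choose_succ_succ (w.count s - 1) (a - 1)
    rw [Nat.succ_eq_add_one, Nat.succ_eq_add_one, Nat.sub_add_cancel (by omega),
      Nat.sub_add_cancel (by omega)] at h6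
    by_contra! hcon
    have h7 : w.count s - 1 ≤ (w.count s - 1).choose (a - 1) :=
      le_choose_of_lt (by omega) (by omega)
    omega
  rcases hbm with rfl | hb' <;> rcases haz with rfl | hz'
  · omega
  · have h5 := hblock (a + 1) (w.count (!s) - 1) (by omega)
    rw [← h4, hz', Nat.choose_self, Nat.choose_one_right, Nat.choose_one_right, one_mul,
      Nat.choose_succ_self_right] at h5
    have h6 := (Nat.mul_le_mul_right (w.count (!s) - 1) (show 2 ≤ a + 1 by omega)).trans h5
    omega
  · have h5 := hblock (w.count s - 1) (b + 1) (by omega)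
    rw [← h4, hb', Nat.choose_self, Nat.choose_one_right, Nat.choose_one_right, mul_one,
      Nat.choose_succ_self_right] at h5
    have h6 := (Nat.mul_le_mul_left (w.count s - 1) (show 2 ≤ b + 1 by omega)).trans h5
    omega
  · omega

/-! ### Words with three runs -/

/-- The terms of `numOcc_three_blocks`, as a function of the positions of the middle block. -/
def blockWeight (s : Bool) (a c : ℕ) (w : BinaryWord) (S : Finset ℕ) : ℕ :=
  (leftCount s w S).choose a * (rightCount s w S).choose c

/-- If all positions in `S` have the same number of letters `s` to their left, then the weight of
`S` is the weight of any of its elements. -/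
theorem blockWeight_eq_of_forall_leftCount_eq {s : Bool} (a c : ℕ) {w : BinaryWord} {S : Finset ℕ}
    {i : ℕ} (hS : S ⊆ positions (!s) w) (hi : i ∈ positions (!s) w) (hne : S.Nonempty)
    (h : ∀ j ∈ S, leftCount s w {j} = leftCount s w {i}) :
    blockWeight s a c w S = blockWeight s a c w {i} := by
  obtain ⟨j, hj, hlj⟩ := exists_leftCount_eq_singleton s w hne
  obtain ⟨k, hk, hrk⟩ := exists_rightCount_eq_singleton s w hne
  have h1 := leftCount_add_rightCount_singleton s w (hS hk)
  have h2 := leftCount_add_rightCount_singleton s w hi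
  have h3 := h k hk
  rw [blockWeight, blockWeight, hlj, h j hj, hrk, show rightCount s w {k} = rightCount s w {i} by
    omega]

theorem blockWeight_le {s : Bool} {a c : ℕ} {w : BinaryWord} {S : Finset ℕ} {g : ℕ}
    (hg : ∀ x y, x + y = w.count s → x.choose a * y.choose c ≤ g) (hne : S.Nonempty)
    (hS : S ⊆ positions (!s) w) : blockWeight s a c w S ≤ g := by
  obtain ⟨i, hi⟩ := hne
  exact (Nat.mul_le_mul (Nat.choose_le_choose _ (leftCount_le_singleton s w hi))
    (Nat.choose_le_choose _ (rightCount_le_singleton s w hi))).trans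
    (hg _ _ (leftCount_add_rightCount_singleton s w (hS hi)))

/-- A middle block that is interrupted by a letter `s` has less than the maximal weight. -/
theorem blockWeight_lt {s : Bool} {a c : ℕ} (hc : 0 < c) {w : BinaryWord} {S : Finset ℕ} {g : ℕ}
    (hg : ∀ x y, x + y = w.count s → x.choose a * y.choose c ≤ g) (hg0 : 0 < g)
    (hS : S ⊆ positions (!s) w) {i j : ℕ} (hi : i ∈ S) (hj : j ∈ S)
    (hij : leftCount s w {i} ≠ leftCount s w {j}) : blockWeight s a c w S < g := by
  wlog hlt : leftCount s w {i} < leftCount s w {j} generalizing i j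
  · exact this hj hi hij.symm (by omega)
  have h1 := leftCount_add_rightCount_singleton s w (hS hi)
  have h2 := leftCount_add_rightCount_singleton s w (hS hj)
  rcases Nat.eq_zero_or_pos (blockWeight s a c w S) with h0 | h0
  · rwa [h0]
  have h3 := Nat.choose_le_choose a (leftCount_le_singleton s w hi)
  have h4 := Nat.choose_le_choose c (rightCount_le_singleton s w hj)
  have h5 : 0 < (leftCount s w S).choose a := Nat.pos_of_mul_pos_right h0
  have h6 : 0 < (rightCount s w S).choose c := Nat.pos_of_mul_pos_left h0
  have h7 : c ≤ rightCount s w {j} := le_of_choose_pos (h6.trans_le h4)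
  have h8 : (rightCount s w {j}).choose c < (rightCount s w {i}).choose c :=
    choose_lt_choose_left hc (by omega) (by omega)
  calc blockWeight s a c w S
      ≤ (leftCount s w {i}).choose a * (rightCount s w {j}).choose c := Nat.mul_le_mul h3 h4
    _ < (leftCount s w {i}).choose a * (rightCount s w {i}).choose c :=
        Nat.mul_lt_mul_of_pos_left h8 (h5.trans_le h3)
    _ ≤ g := hg _ _ h1

/-- If an interrupted `S` had weight `g - 1`, then moving all of `S` to its first or to its last
position would raise the weight by at most one, so that both factors of the weight of `S` would be
`1` and `g = 2`. -/
theorem blockWeight_add_one_ne_of_two_lt {s : Bool} {a c : ℕ} (hc : 0 < c) (ha : 0 < a)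
    {w : BinaryWord} {S : Finset ℕ} {g : ℕ}
    (hg : ∀ x y, x + y = w.count s → x.choose a * y.choose c ≤ g) (hg2 : 2 < g)
    (hg' : ∀ x y, x + y = w.count s → x.choose a * y.choose c + 1 ≠ g)
    (hne : S.Nonempty) (hS : S ⊆ positions (!s) w) : blockWeight s a c w S + 1 ≠ g := by
  intro h
  obtain ⟨i, hi, hli⟩ := exists_leftCount_eq_singleton s w hne
  obtain ⟨j, hj, hrj⟩ := exists_rightCount_eq_singleton s w hne
  have h1 := leftCount_add_rightCount_singleton s w (hS hi)
  have h2 := leftCount_add_rightCount_singleton s w (hS hj)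
  have h3 := leftCount_le_singleton s w hj
  rw [blockWeight, hrj, hli] at h
  rw [hli] at h3
  rcases h3.eq_or_lt with heq | hlt
  · rw [heq] at h
    exact hg' _ _ h2 h
  · have hpos : 0 < (leftCount s w {i}).choose a * (rightCount s w {j}).choose c := by omega
    have hcj := le_of_choose_pos (Nat.pos_of_mul_pos_left hpos)
    have hai := le_of_choose_pos (Nat.pos_of_mul_pos_right hpos)
    have h4 : (rightCount s w {j}).choose c < (rightCount s w {i}).choose c :=
      choose_lt_choose_left hc (by omega) (by omega)
    have h5 : (leftCount s w {i}).choose a < (leftCount s w {j}).choose a :=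
      choose_lt_choose_left ha (by omega) (by omega)
    have h6 := (Nat.mul_le_mul_left ((leftCount s w {i}).choose a) (Nat.succ_le_of_lt h4)).trans
      (hg _ _ h1)
    have h7 := (Nat.mul_le_mul_right ((rightCount s w {j}).choose c) (Nat.succ_le_of_lt h5)).trans
      (hg _ _ h2)
    rw [Nat.succ_eq_add_one, mul_add, mul_one] at h6
    rw [Nat.succ_eq_add_one, add_mul, one_mul] at h7
    have h8 : (leftCount s w {i}).choose a ≤ 1 := by omega
    have h9 : (rightCount s w {j}).choose c ≤ 1 := by omega
    have := Nat.mul_le_mul h8 h9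
    omega

/-- The value `M - 1` is not taken by `s ^ a t ^ b s ^ c`: in a word with this value exactly one
choice of the block `t ^ b` would be deficient. -/
theorem three_blocks_gap (s : Bool) {a b c n : ℕ} (ha : 0 < a) (hb : 0 < b) (hc : 0 < c)
    (habc : 4 ≤ a + b + c) (hn : a + b + c + 3 ≤ n) :
    2 ≤ maxOcc n (List.replicate a s ++ (List.replicate b (!s) ++ List.replicate c s)) ∧
    ∀ w : BinaryWord, w.length = n →
      numOcc (List.replicate a s ++ (List.replicate b (!s) ++ List.replicate c s)) w + 1 ≠
        maxOcc n (List.replicate a s ++ (List.replicate b (!s) ++ List.replicate c s)) := by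
  have hblock : ∀ i m j, i + m + j = n → i.choose a * m.choose b * j.choose c ≤
      maxOcc n (List.replicate a s ++ (List.replicate b (!s) ++ List.replicate c s)) := by
    intro i m j hsum
    rw [← numOcc_three_blocks_blocks s a hb]
    exact numOcc_le_maxOcc _ (by simp; omega)
  have hnum : ∀ w, numOcc (List.replicate a s ++ (List.replicate b (!s) ++ List.replicate c s)) w =
      ∑ S ∈ (positions (!s) w).powersetCard b, blockWeight s a c w S :=
    fun w => numOcc_three_blocks s a hb c w
  obtain ⟨w', hw', hmax⟩ := exists_numOcc_eq_maxOcc n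
    (List.replicate a s ++ (List.replicate b (!s) ++ List.replicate c s))
  set p := List.replicate a s ++ (List.replicate b (!s) ++ List.replicate c s)
  set M := maxOcc n p
  have hM4 : 4 ≤ M := by
    have h1 := hblock a (n - a - c) c (by omega)
    have h2 := le_choose_of_lt hb (show b < n - a - c by omega)
    rw [Nat.choose_self, Nat.choose_self, one_mul, mul_one] at h1
    omega
  have hbest : ∀ z, ∃ x y : ℕ, x + y = z ∧
      ∀ x' y' : ℕ, x' + y' = z → x'.choose a * y'.choose c ≤ x.choose a * y.choose c := by
    intro z
    obtain ⟨x, hx, hmx⟩ := Finset.exists_max_image (Finset.range (z + 1))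
      (fun x => x.choose a * (z - x).choose c) ⟨0, by simp⟩
    refine ⟨x, z - x, by have := Finset.mem_range.1 hx; omega, fun x' y' h => ?_⟩
    have := hmx x' (Finset.mem_range.2 (by omega))
    rwa [show z - x' = y' by omega] at this
  have hterm : ∀ w : BinaryWord, ∀ g,
      (∀ x y, x + y = w.count s → x.choose a * y.choose c ≤ g) →
      ∀ S ∈ (positions (!s) w).powersetCard b, blockWeight s a c w S ≤ g := by
    intro w g hg S hS
    obtain ⟨hS, hcard⟩ := Finset.mem_powersetCard.1 hS
    exact blockWeight_le hg (Finset.card_pos.1 (by omega)) hS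
  have hle : ∀ (w : BinaryWord) (g : ℕ),
      (∀ x y, x + y = w.count s → x.choose a * y.choose c ≤ g) →
      numOcc p w ≤ (w.count (!s)).choose b * g := by
    intro w g hg
    rw [hnum, ← card_positions (!s), ← Finset.card_powersetCard, ← smul_eq_mul]
    exact Finset.sum_le_card_nsmul _ _ _ (hterm w g hg)
  have hatt : ∃ i m j, i + m + j = n ∧ i.choose a * m.choose b * j.choose c = M := by
    obtain ⟨x, y, hxy, hg⟩ := hbest (w'.count s)
    have h := count_add_count_not s w'
    have h1 := hle w' _ hg
    have h2 := hblock x (w'.count (!s)) y (by omega)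
    refine ⟨x, w'.count (!s), y, by omega, le_antisymm h2 ?_⟩
    rw [← hmax]
    exact h1.trans (le_of_eq (by ring))
  refine ⟨by omega, fun w hw h => ?_⟩
  have hlen := (count_add_count_not s w).trans hw
  obtain ⟨x, y, hxy, hg⟩ := hbest (w.count s)
  have hne : ∀ i m j, i + m + j = n → i.choose a * m.choose b * j.choose c + 1 ≠ M :=
    fun i m j => three_choose_add_one_ne ha hb hc habc hn hblock hatt (by omega)
  have h1 := hle w _ hg
  have h2 := hblock x (w.count (!s)) y (by omega)
  have h3 := hne x (w.count (!s)) y (by omega)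
  rw [mul_right_comm, mul_comm] at h2 h3
  have h4 : (w.count (!s)).choose b * (x.choose a * y.choose c) = M := by omega
  have hI := card_positions (!s) w
  have hpos : 0 < (w.count (!s)).choose b * (x.choose a * y.choose c) := by omega
  have hm := le_of_choose_pos (Nat.pos_of_mul_pos_right hpos)
  have hg0 := Nat.pos_of_mul_pos_left hpos
  have hxa := le_of_choose_pos (Nat.pos_of_mul_pos_right hg0)
  have hyc := le_of_choose_pos (Nat.pos_of_mul_pos_left hg0)
  rw [hnum, ← h4, ← card_positions (!s), ← Finset.card_powersetCard] at h
  obtain ⟨S₀, hS₀, hdef, huniq⟩ := exists_deficit_of_sum_add_one (hterm w _ hg) h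
  obtain ⟨hS₀I, hS₀c⟩ := Finset.mem_powersetCard.1 hS₀
  have hS₀ne : S₀.Nonempty := Finset.card_pos.1 (by omega)
  rcases (show b = 1 ∨ 2 ≤ b by omega) with rfl | hb2
  · -- a single letter `t`: the problem reduces to the two outer blocks
    obtain ⟨i, rfl⟩ := Finset.card_eq_one.1 hS₀c
    rw [Nat.choose_one_right] at h4
    have hz : a + c + 2 ≤ w.count s := by
      by_contra hz
      -- otherwise one outer block is minimal, and enlarging it at the expense of the letters `t`
      -- would increase the number of occurrences
      have hm3 : 3 ≤ w.count (!s) := by omega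
      rcases (show x = a ∨ y = c by omega) with rfl | rfl
      · have h5 := hblock (x + 1) (w.count (!s) - 1) y (by omega)
        rw [← h4, Nat.choose_self, one_mul, Nat.choose_one_right, Nat.choose_succ_self_right] at h5
        have h6 := Nat.le_of_mul_le_mul_right h5 (Nat.pos_of_mul_pos_left hg0)
        have h7 := (Nat.mul_le_mul_right (w.count (!s) - 1) (show 2 ≤ x + 1 by omega)).trans h6
        omega
      · have h5 := hblock x (w.count (!s) - 1) (y + 1) (by omega)
        rw [← h4, Nat.choose_self, mul_one, Nat.choose_one_right, Nat.choose_succ_self_right,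
          mul_assoc, mul_comm] at h5
        have h6 := Nat.le_of_mul_le_mul_right h5 (Nat.pos_of_mul_pos_right hg0)
        have h7 := (Nat.mul_le_mul_left (w.count (!s) - 1) (show 2 ≤ y + 1 by omega)).trans h6
        omega
    exact two_choose_add_one_ne ha hc (by omega) hz hg ⟨x, y, hxy, rfl⟩
      (leftCount_add_rightCount_singleton s w (hS₀I (Finset.mem_singleton_self i))) hdef
  · rcases hm.eq_or_lt with hm | hm
    · rw [← hm, Nat.choose_self, one_mul] at h4
      refine blockWeight_add_one_ne_of_two_lt hc ha hg (by omega) (fun x' y' h' => ?_) hS₀ne hS₀I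
        hdef
      rw [h4]
      have := hne x' b y' (by omega)
      rwa [Nat.choose_self, mul_one] at this
    · by_cases hall : ∀ i ∈ positions (!s) w, ∀ j ∈ positions (!s) w,
          leftCount s w {i} = leftCount s w {j}
      · -- the letters `t` form one block: all weights are equal
        obtain ⟨i, hi⟩ := hS₀ne
        have hconst : ∀ S ∈ (positions (!s) w).powersetCard b,
            blockWeight s a c w S = blockWeight s a c w {i} := by
          intro S hS
          obtain ⟨hS, hcard⟩ := Finset.mem_powersetCard.1 hS
          exact blockWeight_eq_of_forall_leftCount_eq a c hS (hS₀I hi)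
            (Finset.card_pos.1 (by omega)) fun j hj => hall j (hS hj) i (hS₀I hi)
        have hcard : 1 < ((positions (!s) w).powersetCard b).card := by
          rw [Finset.card_powersetCard, hI]
          have := le_choose_of_lt hb hm
          omega
        obtain ⟨S, hS, hne'⟩ := Finset.exists_mem_ne hcard S₀
        refine hne' (huniq S hS ?_)
        rw [hconst S hS, ← hconst S₀ hS₀]
        omega
      · -- two letters `t` separated by a letter `s` lie in two different deficient blocks
        push Not at hall
        obtain ⟨i, hi, j, hj, hij⟩ := hall
        have hbad : ∀ S ∈ (positions (!s) w).powersetCard b, ∀ i ∈ S, ∀ j ∈ S,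
            leftCount s w {i} ≠ leftCount s w {j} → S = S₀ := fun S hS i hi j hj hij =>
          huniq S hS (blockWeight_lt hc hg hg0 (Finset.mem_powersetCard.1 hS).1 hi hj hij)
        have hijne : i ≠ j := fun h => hij (h ▸ rfl)
        obtain ⟨S, hijS, hSI, hScard⟩ := Finset.exists_subsuperset_card_eq
          (show {i, j} ⊆ positions (!s) w from
            Finset.insert_subset hi (Finset.singleton_subset_iff.2 hj))
          (show ({i, j} : Finset ℕ).card ≤ b by rw [Finset.card_pair hijne]; exact hb2)
          (by omega)
        have hiS : i ∈ S := hijS (Finset.mem_insert_self _ _)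
        have hjS : j ∈ S := hijS (Finset.mem_insert_of_mem (Finset.mem_singleton_self _))
        have hS := hbad S (Finset.mem_powersetCard.2 ⟨hSI, hScard⟩) i hiS j hjS hij
        obtain ⟨k, hk, hkS⟩ := Finset.exists_mem_notMem_of_card_lt_card
          (show S.card < (positions (!s) w).card by omega)
        have hswap : ∀ u ∈ S, ∀ v ∈ S, u ≠ v → leftCount s w {k} ≠ leftCount s w {u} → False := by
          intro u hu v hv huv hku
          have hkv : k ∉ S.erase v := fun h => hkS (Finset.mem_of_mem_erase h)
          have hS' : insert k (S.erase v) ∈ (positions (!s) w).powersetCard b := by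
            refine Finset.mem_powersetCard.2 ⟨Finset.insert_subset hk
              ((Finset.erase_subset _ _).trans hSI), ?_⟩
            rw [Finset.card_insert_of_notMem hkv, Finset.card_erase_of_mem hv]
            omega
          have := hbad _ hS' k (Finset.mem_insert_self _ _) u
            (Finset.mem_insert_of_mem (Finset.mem_erase.2 ⟨huv, hu⟩)) hku
          exact hkS (hS.trans this.symm ▸ Finset.mem_insert_self _ _)
        by_cases hki : leftCount s w {k} = leftCount s w {i}
        · exact hswap j hjS i hiS hijne.symm (hki ▸ hij)
        · exact hswap i hiS j hjS hijne hki

/-! ### Alternating words with at most two runs -/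

/-- There is no internal zero if every number below a value of `c_p` on words of length `n` is
again such a value. -/
theorem not_hasInternalZero_of_forall_lt {p : BinaryWord} {n : ℕ}
    (h : ∀ w : BinaryWord, w.length = n → ∀ k < numOcc p w,
      ∃ w' : BinaryWord, w'.length = n ∧ numOcc p w' = k) :
    ¬ HasInternalZero (countWords n p) := by
  rintro ⟨k₁, k₂, k₃, -, h23, -, h2, h3⟩
  obtain ⟨w, hw, rfl⟩ := countWords_ne_zero_iff.1 h3
  exact countWords_ne_zero_iff.2 (h w hw k₂ h23) h2

theorem not_hasInternalZero_nil (n : ℕ) : ¬ HasInternalZero (countWords n []) := by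
  rintro ⟨k₁, k₂, k₃, h12, h23, h1, -, h3⟩
  obtain ⟨w, -, hw⟩ := countWords_ne_zero_iff.1 h1
  obtain ⟨w', -, hw'⟩ := countWords_ne_zero_iff.1 h3
  rw [numOcc_nil_left] at hw hw'
  omega

theorem numOcc_singleton (s : Bool) (w : BinaryWord) : numOcc [s] w = w.count s := by
  simpa using numOcc_replicate s 1 w

theorem not_hasInternalZero_singleton (s : Bool) (n : ℕ) :
    ¬ HasInternalZero (countWords n [s]) := by
  refine not_hasInternalZero_of_forall_lt fun w hw k hk => ?_
  rw [numOcc_singleton] at hk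
  have hkn : k ≤ n := hw ▸ hk.le.trans List.count_le_length
  refine ⟨List.replicate k s ++ List.replicate (n - k) (!s), by simp [hkn], ?_⟩
  simp [numOcc_singleton, List.count_append, List.count_replicate]

theorem numOcc_pair_cons_self (s : Bool) (w : BinaryWord) :
    numOcc [s, !s] (s :: w) = numOcc [s, !s] w + w.count (!s) := by
  rw [numOcc_cons_cons, if_pos rfl, numOcc_singleton]

theorem numOcc_pair_cons_not (s : Bool) (w : BinaryWord) :
    numOcc [s, !s] ((!s) :: w) = numOcc [s, !s] w := by
  rw [numOcc_cons_cons, if_neg (by simp), add_zero]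

/-- Replacing a factor `s t` by `t s` removes exactly one occurrence of `s t`. -/
theorem exists_numOcc_pair_add_one_eq (s : Bool) (w : BinaryWord) (h : 0 < numOcc [s, !s] w) :
    ∃ w' : BinaryWord, w'.length = w.length ∧ w'.count (!s) = w.count (!s) ∧
      numOcc [s, !s] w' + 1 = numOcc [s, !s] w := by
  induction w with
  | nil =>
    rw [numOcc_cons_nil] at h
    exact absurd h (lt_irrefl 0)
  | cons b w ih =>
    by_cases hb : b = s
    · subst hb
      cases w with
      | nil =>
        rw [numOcc_pair_cons_self, numOcc_cons_nil] at h
        simp at h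
      | cons d w =>
        by_cases hd : d = b
        · subst hd
          have h0 : 0 < numOcc [d, !d] (d :: w) := by
            rw [numOcc_pair_cons_self, List.count_cons_of_ne (by simp)] at h
            rw [numOcc_pair_cons_self] at h ⊢
            omega
          obtain ⟨w', hl, hc, hn⟩ := ih h0
          refine ⟨d :: w', by simp [hl], by simp [hc], ?_⟩
          rw [numOcc_pair_cons_self, numOcc_pair_cons_self d (d :: w), hc]
          omega
        · obtain rfl : d = !b := by cases d <;> cases b <;> simp_all
          refine ⟨(!b) :: b :: w, by simp, by simp, ?_⟩
          rw [numOcc_pair_cons_not, numOcc_pair_cons_self, numOcc_pair_cons_self,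
            numOcc_pair_cons_not, List.count_cons_self]
          omega
    · obtain rfl : b = !s := by cases b <;> cases s <;> simp_all
      rw [numOcc_pair_cons_not] at h ⊢
      obtain ⟨w', hl, hc, hn⟩ := ih h
      exact ⟨(!s) :: w', by simp [hl], by simp [hc], by rw [numOcc_pair_cons_not, hn]⟩

theorem not_hasInternalZero_pair (s : Bool) (n : ℕ) :
    ¬ HasInternalZero (countWords n [s, !s]) := by
  refine not_hasInternalZero_of_forall_lt fun w hw k hk => ?_
  have key : ∀ d (w : BinaryWord), w.length = n → numOcc [s, !s] w = k + d →
      ∃ w' : BinaryWord, w'.length = n ∧ numOcc [s, !s] w' = k := by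
    intro d
    induction d with
    | zero => exact fun w hw h => ⟨w, hw, h⟩
    | succ d ih =>
      intro w hw h
      obtain ⟨w', hl, -, hn⟩ := exists_numOcc_pair_add_one_eq s w (by omega)
      exact ih w' (hl.trans hw) (by omega)
  exact key (numOcc [s, !s] w - k) w hw (by omega)

/-! ### Alternating words with three runs -/

theorem numOcc_pair_insert_not (s : Bool) (u v : BinaryWord) :
    numOcc [!s, s] (u ++ (!s) :: v) = numOcc [!s, s] (u ++ v) + v.count s := by
  induction u with
  | nil =>
    have := numOcc_pair_cons_self (!s) v
    rwa [Bool.not_not] at this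
  | cons b u ih =>
    rw [List.cons_append, List.cons_append, numOcc_cons_cons, numOcc_cons_cons, ih,
      numOcc_singleton, numOcc_singleton, List.count_append, List.count_append,
      List.count_cons_of_ne (by simp)]
    omega

/-- A letter `t` with `x` letters `s` to its left and `y` letters `s` to its right takes part in
`x y` occurrences of `s t s`. -/
theorem numOcc_triple_insert_not (s : Bool) (u v : BinaryWord) :
    numOcc [s, !s, s] (u ++ (!s) :: v) =
      numOcc [s, !s, s] (u ++ v) + u.count s * v.count s := by
  induction u with
  | nil => rw [List.nil_append, numOcc_cons_cons, if_neg (by simp)]; simp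
  | cons b u ih =>
    rw [List.cons_append, List.cons_append, numOcc_cons_cons, numOcc_cons_cons, ih,
      numOcc_pair_insert_not]
    by_cases hb : s = b
    · subst hb
      rw [if_pos rfl, if_pos rfl, List.count_cons_self]
      ring
    · rw [if_neg hb, if_neg hb, List.count_cons_of_ne (Ne.symm hb)]
      ring

theorem exists_append_of_le_count (s : Bool) (w : BinaryWord) {x : ℕ} (hx : x ≤ w.count s) :
    ∃ u v, w = u ++ v ∧ u.count s = x := by
  induction w generalizing x with
  | nil => exact ⟨[], [], rfl, (Nat.le_zero.1 hx).symm⟩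
  | cons b w ih =>
    rcases Nat.eq_zero_or_pos x with rfl | hx0
    · exact ⟨[], b :: w, rfl, rfl⟩
    · by_cases hb : b = s
      · subst hb
        rw [List.count_cons_self] at hx
        obtain ⟨u, v, rfl, hu⟩ := ih (x := x - 1) (by omega)
        exact ⟨b :: u, v, rfl, by rw [List.count_cons_self]; omega⟩
      · rw [List.count_cons_of_ne hb] at hx
        obtain ⟨u, v, rfl, hu⟩ := ih hx
        exact ⟨b :: u, v, rfl, by rw [List.count_cons_of_ne hb, hu]⟩

/-- The number of occurrences of `s t s` in a word with `z` letters `s`, in terms of the list `X`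
of the numbers of letters `s` to the left of each letter `t`. -/
def tripleSum (z : ℕ) (X : List ℕ) : ℕ := (X.map fun x => x * (z - x)).sum

theorem exists_numOcc_triple_eq_tripleSum (s : Bool) (z : ℕ) (X : List ℕ) (hX : ∀ x ∈ X, x ≤ z) :
    ∃ w : BinaryWord, w.length = z + X.length ∧ numOcc [s, !s, s] w = tripleSum z X := by
  suffices h : ∃ w : BinaryWord, w.count s = z ∧ w.length = z + X.length ∧
      numOcc [s, !s, s] w = tripleSum z X from h.imp fun _ h => h.2
  induction X with
  | nil =>
    refine ⟨List.replicate z s, by simp, by simp, ?_⟩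
    have := numOcc_three_blocks_blocks s 1 one_pos 1 z 0 0
    simpa [tripleSum] using this
  | cons x X ih =>
    obtain ⟨w, hz, hl, hn⟩ := ih fun y hy => hX y (List.mem_cons_of_mem _ hy)
    obtain ⟨u, v, rfl, hu⟩ := exists_append_of_le_count s w (hz.symm ▸ hX x List.mem_cons_self)
    rw [List.count_append] at hz
    refine ⟨u ++ (!s) :: v, by simpa [List.count_append] using hz, ?_, ?_⟩
    · simp only [List.length_append, List.length_cons] at hl ⊢
      omega
    · rw [numOcc_triple_insert_not, hn, hu, tripleSum, tripleSum, List.map_cons, List.sum_cons,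
        show v.count s = z - x by omega]
      ring

theorem numOcc_triple_le (s : Bool) (w : BinaryWord) :
    numOcc [s, !s, s] w ≤ w.count (!s) * (w.count s ^ 2 / 4) := by
  induction hm : w.count (!s) generalizing w with
  | zero =>
    have h := numOcc_three_blocks s 1 one_pos 1 w
    rw [Finset.powersetCard_eq_empty.2 (by rw [card_positions]; omega), Finset.sum_empty] at h
    rw [zero_mul]
    exact h.le
  | succ m ih =>
    obtain ⟨u, v, rfl⟩ := List.append_of_mem (List.count_pos_iff.1 (by omega : 0 < w.count (!s)))
    rw [List.count_append, List.count_cons_self] at hm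
    have h1 := ih (u ++ v) (by rw [List.count_append]; omega)
    rw [numOcc_triple_insert_not]
    rw [List.count_append] at h1
    rw [List.count_append, List.count_cons_of_ne (by simp), add_mul, one_mul]
    refine Nat.add_le_add h1 ((Nat.le_div_iff_mul_le (by norm_num)).2 ?_)
    zify
    nlinarith [sq_nonneg ((u.count s : ℤ) - v.count s)]

/-- The maximum of `m * ⌊z² / 4⌋` with `z + m` fixed is taken at an even `z = 2 q`. -/
theorem exists_mul_sq_div_four_le {n z m : ℕ} (h : z + m = n) :
    ∃ q m', 2 * q + m' = n ∧ m * (z ^ 2 / 4) ≤ m' * q ^ 2 := by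
  obtain ⟨r, rfl | rfl⟩ := Nat.even_or_odd' z
  · refine ⟨r, m, h, le_of_eq ?_⟩
    rw [show (2 * r) ^ 2 = 4 * r ^ 2 by ring, Nat.mul_div_cancel_left _ (by norm_num)]
  · have hdiv : (2 * r + 1) ^ 2 / 4 = r ^ 2 + r := by
      rw [show (2 * r + 1) ^ 2 = 1 + 4 * (r ^ 2 + r) by ring,
        Nat.add_mul_div_left _ _ (by norm_num)]
      simp
    rw [hdiv]
    rcases Nat.lt_or_ge r m with hm | hm
    · obtain ⟨m, rfl⟩ := Nat.exists_eq_succ_of_ne_zero (by omega : m ≠ 0)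
      refine ⟨r + 1, m, by omega, ?_⟩
      rw [Nat.succ_eq_add_one]
      nlinarith [Nat.mul_le_mul_left (r + 1) (Nat.lt_succ_iff.1 hm)]
    · refine ⟨r, m + 1, by omega, ?_⟩
      nlinarith [Nat.mul_le_mul_left r hm]

/-- With `z = 2 q` letters `s` and at least four letters `t`, Lagrange's four-square theorem makes
any deficit `D ≤ q²` from the maximum possible: `(q - a) (q + a) = q² - a²`. -/
theorem exists_numOcc_triple_eq_of_four_le (s : Bool) {q m k : ℕ} (hm : 4 ≤ m)
    (hk : k ≤ m * q ^ 2) (hk' : (m - 1) * q ^ 2 ≤ k) :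
    ∃ w : BinaryWord, w.length = 2 * q + m ∧ numOcc [s, !s, s] w = k := by
  obtain ⟨m, rfl⟩ := Nat.exists_eq_add_of_le hm
  obtain ⟨D, hD⟩ := Nat.exists_eq_add_of_le hk
  obtain ⟨a, b, c, d, habcd⟩ := Nat.sum_four_squares D
  have hDq : D ≤ q ^ 2 := by
    rw [show 4 + m - 1 = 3 + m by omega] at hk'
    nlinarith
  have hle : ∀ e, e ^ 2 ≤ D → e ≤ q := fun e he =>
    (Nat.pow_le_pow_iff_left two_ne_zero).1 (he.trans hDq)
  have ha := hle a (by omega)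
  have hb := hle b (by omega)
  have hc := hle c (by omega)
  have hd := hle d (by omega)
  have hterm : ∀ e ≤ q, (q - e) * (2 * q - (q - e)) + e ^ 2 = q ^ 2 := by
    intro e he
    obtain ⟨f, rfl⟩ := Nat.exists_eq_add_of_le he
    rw [show e + f - e = f by omega, show 2 * (e + f) - f = 2 * e + f by omega]
    ring
  obtain ⟨w, hl, hw⟩ := exists_numOcc_triple_eq_tripleSum s (2 * q)
    ((q - a) :: (q - b) :: (q - c) :: (q - d) :: List.replicate m q) (by
      intro x hx
      simp only [List.mem_cons, List.mem_replicate] at hx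
      omega)
  refine ⟨w, by rw [hl]; simp; omega, ?_⟩
  rw [hw, tripleSum]
  simp only [List.map_cons, List.sum_cons, List.map_replicate, List.sum_replicate, smul_eq_mul]
  have h5 := hterm 0 (Nat.zero_le q)
  rw [Nat.sub_zero, zero_pow two_ne_zero, add_zero] at h5
  have h1 := hterm a ha
  have h2 := hterm b hb
  have h3 := hterm c hc
  have h4 := hterm d hd
  rw [h5]
  rw [add_mul] at hD
  omega

theorem exists_numOcc_triple_eq_of_mem (s : Bool) {n k : ℕ} {T : List (ℕ × List ℕ)}
    (h : ∃ x ∈ T, (∀ y ∈ x.2, y ≤ x.1) ∧ x.1 + x.2.length = n ∧ tripleSum x.1 x.2 = k) :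
    ∃ w : BinaryWord, w.length = n ∧ numOcc [s, !s, s] w = k := by
  obtain ⟨x, -, hx, rfl, rfl⟩ := h
  exact exists_numOcc_triple_eq_tripleSum s x.1 x.2 hx

/-- Values that are not within reach of the four-square theorem, because the maximum is taken
with fewer than four letters `t`, are given by an explicit number `z` of letters `s` and an explicit
list of the numbers of letters `s` to the left of each letter `t`. -/
theorem exists_numOcc_triple_eq_seven (s : Bool) {k : ℕ} (hk : k ≤ 12) :
    ∃ w : BinaryWord, w.length = 7 ∧ numOcc [s, !s, s] w = k := by
  have h : ∀ k ∈ Finset.Icc 0 12, ∃ x ∈ ([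
    (7, []), (2, [1, 0, 0, 0, 0]), (3, [1, 0, 0, 0]), (4, [1, 0, 0]), (5, [1, 0]), (6, [1]),
    (5, [2, 0]), (4, [2, 1, 0]), (6, [2]), (6, [3]), (5, [2, 1]), (4, [2, 2, 1]), (5, [2, 2])] :
      List (ℕ × List ℕ)),
      (∀ y ∈ x.2, y ≤ x.1) ∧ x.1 + x.2.length = 7 ∧ tripleSum x.1 x.2 = k := by decide
  exact exists_numOcc_triple_eq_of_mem s (h k (Finset.mem_Icc.2 ⟨Nat.zero_le k, hk⟩))

theorem exists_numOcc_triple_eq_eight (s : Bool) {k : ℕ} (hk : 12 < k) (hk' : k ≤ 18) :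
    ∃ w : BinaryWord, w.length = 8 ∧ numOcc [s, !s, s] w = k := by
  have h : ∀ k ∈ Finset.Icc 13 18, ∃ x ∈ ([
    (6, [2, 1]), (6, [3, 1]), (4, [2, 2, 2, 1]), (6, [2, 2]), (6, [3, 2]), (6, [3, 3])] :
      List (ℕ × List ℕ)),
      (∀ y ∈ x.2, y ≤ x.1) ∧ x.1 + x.2.length = 8 ∧ tripleSum x.1 x.2 = k := by decide
  exact exists_numOcc_triple_eq_of_mem s (h k (Finset.mem_Icc.2 ⟨hk, hk'⟩))

theorem exists_numOcc_triple_eq_nine (s : Bool) {k : ℕ} (hk : 18 < k) (hk' : k ≤ 27) :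
    ∃ w : BinaryWord, w.length = 9 ∧ numOcc [s, !s, s] w = k := by
  have h : ∀ k ∈ Finset.Icc 19 27, ∃ x ∈ ([
    (6, [3, 1, 1]), (7, [2, 2]), (6, [2, 2, 1]), (7, [3, 2]), (6, [3, 3, 1]), (7, [3, 3]),
    (6, [3, 2, 2]), (6, [3, 3, 2]), (6, [3, 3, 3])] :
      List (ℕ × List ℕ)),
      (∀ y ∈ x.2, y ≤ x.1) ∧ x.1 + x.2.length = 9 ∧ tripleSum x.1 x.2 = k := by decide
  exact exists_numOcc_triple_eq_of_mem s (h k (Finset.mem_Icc.2 ⟨hk, hk'⟩))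

theorem exists_numOcc_triple_eq_eleven (s : Bool) {k : ℕ} (hk : 36 < k) (hk' : k ≤ 48) :
    ∃ w : BinaryWord, w.length = 11 ∧ numOcc [s, !s, s] w = k := by
  have h : ∀ k ∈ Finset.Icc 37 48, ∃ x ∈ ([
    (8, [3, 3, 1]), (9, [4, 3]), (8, [4, 4, 1]), (9, [4, 4]), (6, [3, 3, 3, 3, 1]),
    (8, [3, 3, 2]), (8, [4, 3, 2]), (8, [4, 4, 2]), (8, [3, 3, 3]), (8, [4, 3, 3]),
    (8, [4, 4, 3]), (8, [4, 4, 4])] :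
      List (ℕ × List ℕ)),
      (∀ y ∈ x.2, y ≤ x.1) ∧ x.1 + x.2.length = 11 ∧ tripleSum x.1 x.2 = k := by decide
  exact exists_numOcc_triple_eq_of_mem s (h k (Finset.mem_Icc.2 ⟨hk, hk'⟩))

theorem exists_forall_mul_sq_le (n : ℕ) : ∃ q m, 2 * q + m = n ∧
    ∀ q' m', 2 * q' + m' = n → m' * q' ^ 2 ≤ m * q ^ 2 := by
  obtain ⟨q, hq, hmax⟩ := Finset.exists_max_image (Finset.range (n / 2 + 1))
    (fun q => (n - 2 * q) * q ^ 2) ⟨0, by simp⟩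
  refine ⟨q, n - 2 * q, by have := Finset.mem_range.1 hq; omega, fun q' m' h => ?_⟩
  have := hmax q' (Finset.mem_range.2 (by omega))
  rwa [show n - 2 * q' = m' by omega] at this

/-- A maximum of `m q²` with `2 q + m` fixed has `m ≥ 4`, apart from small cases. -/
theorem four_le_of_forall_mul_sq_le {n q m : ℕ} (hn : n = 10 ∨ 12 ≤ n) (h : 2 * q + m = n)
    (hmax : ∀ q' m', 2 * q' + m' = n → m' * q' ^ 2 ≤ m * q ^ 2) : 4 ≤ m := by
  by_contra! hm
  rcases hn with rfl | hn
  · have h1 := hmax 3 4 rfl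
    have hq : q ≤ 5 := by omega
    interval_cases q <;> omega
  · obtain ⟨q, rfl⟩ := Nat.exists_eq_add_of_le (show 5 ≤ q by omega)
    have h1 := hmax (q + 4) (m + 2) (by omega)
    interval_cases m <;> nlinarith

/-- Every number up to `m q²`, where `2 q + m = n ≥ 7`, is the number of occurrences of `s t s` in
some word of length `n`. -/
theorem exists_numOcc_triple_eq (s : Bool) {n : ℕ} (hn : 7 ≤ n) {q m k : ℕ}
    (h : 2 * q + m = n) (hk : k ≤ m * q ^ 2) :
    ∃ w : BinaryWord, w.length = n ∧ numOcc [s, !s, s] w = k := by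
  induction n, hn using Nat.le_induction generalizing q m k with
  | base =>
    refine exists_numOcc_triple_eq_seven s (hk.trans ?_)
    have hq : q ≤ 3 := by omega
    interval_cases q <;> omega
  | succ n hn ih =>
    have hprev : ∀ q m, 2 * q + m = n → k ≤ m * q ^ 2 →
        ∃ w : BinaryWord, w.length = n + 1 ∧ numOcc [s, !s, s] w = k := by
      intro q m h hk
      obtain ⟨w, hl, hw⟩ := ih h hk
      refine ⟨(!s) :: w, by simp [hl], ?_⟩
      rw [numOcc_cons_cons, if_neg (by simp), add_zero, hw]
    rcases (show n = 7 ∨ n = 8 ∨ n = 10 ∨ (n + 1 = 10 ∨ 12 ≤ n + 1) by omega)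
      with rfl | rfl | rfl | hn'
    · rcases Nat.lt_or_ge 12 k with h12 | h12
      · refine exists_numOcc_triple_eq_eight s h12 (hk.trans ?_)
        have hq : q ≤ 4 := by omega
        interval_cases q <;> omega
      · exact hprev 2 3 rfl h12
    · rcases Nat.lt_or_ge 18 k with h18 | h18
      · refine exists_numOcc_triple_eq_nine s h18 (hk.trans ?_)
        have hq : q ≤ 4 := by omega
        interval_cases q <;> omega
      · exact hprev 3 2 rfl h18
    · rcases Nat.lt_or_ge 36 k with h36 | h36
      · refine exists_numOcc_triple_eq_eleven s h36 (hk.trans ?_)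
        have hq : q ≤ 5 := by omega
        interval_cases q <;> omega
      · exact hprev 3 4 rfl h36
    · obtain ⟨q', m', h', hmax⟩ := exists_forall_mul_sq_le (n + 1)
      have hm' := four_le_of_forall_mul_sq_le hn' h' hmax
      rcases le_total k ((m' - 1) * q' ^ 2) with hk' | hk'
      · exact hprev q' (m' - 1) (by omega) hk'
      · rw [← h']
        exact exists_numOcc_triple_eq_of_four_le s hm' (hk.trans (hmax q m h)) hk'

theorem not_hasInternalZero_triple (s : Bool) {n : ℕ} (hn : 7 ≤ n) :
    ¬ HasInternalZero (countWords n [s, !s, s]) := by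
  refine not_hasInternalZero_of_forall_lt fun w hw k hk => ?_
  obtain ⟨q, m, h, hle⟩ := exists_mul_sq_div_four_le ((count_add_count_not s w).trans hw)
  exact exists_numOcc_triple_eq s hn h (hk.le.trans ((numOcc_triple_le s w).trans hle))

end BinaryWord

theorem mainTheorem1 (p : BinaryWord) (hp : BinaryWord.numRuns p ≤ 3) :
    (BinaryWord.IsAlternating p →
      ∀ n : ℕ, 7 ≤ n → ¬ BinaryWord.HasInternalZero (BinaryWord.countWords n p)) ∧
    (¬ BinaryWord.IsAlternating p →
      ∀ n : ℕ, p.length + 3 ≤ n →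
        BinaryWord.HasInternalZero (BinaryWord.countWords n p) ∧
        BinaryWord.countWords n p (BinaryWord.maxOcc n p - 1) = 0) := by
  open BinaryWord in
  rcases eq_of_numRuns_le_three hp with rfl | ⟨s, a, ha, rfl⟩ | ⟨s, a, b, ha, hb, rfl⟩ |
    ⟨s, a, b, c, ha, hb, hc, rfl⟩
  · refine ⟨fun _ n _ => not_hasInternalZero_nil n, fun h => absurd ?_ h⟩
    exact isAlternating_of_getElem?_ne fun i hi => absurd hi (Nat.not_lt_zero _)
  · constructor
    · intro h n _
      have h' := IsAlternating.of_replicate_append (q := []) (s := s) ha (by simp)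
        (by rwa [List.append_nil])
      obtain rfl := h'.1
      exact not_hasInternalZero_singleton s n
    · intro h n hn
      rw [List.length_replicate] at hn
      have h2 : 2 ≤ a := by
        by_contra hlt
        obtain rfl : a = 1 := by omega
        exact h (isAlternating_one s)
      have hgap := one_block_gap s h2 hn
      exact hasInternalZero_of_add_one_ne hgap.1 hgap.2
  · constructor
    · intro h n _
      have hhead := head?_replicate_append_ne hb s []
      rw [List.append_nil] at hhead
      obtain ⟨rfl, h1⟩ := h.of_replicate_append ha hhead
      obtain ⟨rfl, -⟩ := IsAlternating.of_replicate_append (q := []) (s := !s) hb (by simp)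
        (by rwa [List.append_nil])
      exact not_hasInternalZero_pair s n
    · intro h n hn
      rw [List.length_append, List.length_replicate, List.length_replicate] at hn
      have h3 : 3 ≤ a + b := by
        by_contra hlt
        obtain rfl : a = 1 := by omega
        obtain rfl : b = 1 := by omega
        exact h (isAlternating_two s)
      have hgap := two_blocks_gap s ha hb h3 hn
      exact hasInternalZero_of_add_one_ne hgap.1 hgap.2
  · constructor
    · intro h n hn
      obtain ⟨rfl, h1⟩ := h.of_replicate_append ha (head?_replicate_append_ne hb s _)
      have hhead := head?_replicate_append_ne hc (!s) []
      rw [List.append_nil, Bool.not_not] at hhead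
      obtain ⟨rfl, h2⟩ := h1.of_replicate_append hb hhead
      obtain ⟨rfl, -⟩ := IsAlternating.of_replicate_append (q := []) (s := s) hc (by simp)
        (by rwa [List.append_nil])
      exact not_hasInternalZero_triple s hn
    · intro h n hn
      simp only [List.length_append, List.length_replicate] at hn
      have h4 : 4 ≤ a + b + c := by
        by_contra hlt
        obtain rfl : a = 1 := by omega
        obtain rfl : b = 1 := by omega
        obtain rfl : c = 1 := by omega
        exact h (isAlternating_three s)
      have hgap := three_blocks_gap s (n := n) ha hb hc h4 (by omega)
      exact hasInternalZero_of_add_one_ne hgap.1 hgap.2
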